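/- Let $\lambda,\mu,\nu$ be three triples of nonzero complex numbers, each consisting of three distinct entries, with $\lambda_1\lambda_2\lambda_3\,\mu_1\mu_2\mu_3=\nu_1\nu_2\nu_3$. Write the fundamental group of the three-punctured sphere as the free group $\langle a,b\rangle$, where $a$, $b$ and $(ab)^{-1}$ are simple loops around the punctures. Let $\mathcal{M}_B=\mathcal{M}_B(\lambda,\mu,\nu)$ be the $\mathrm{GL}(3,\mathbb{C})$ character variety: the variety (geometric quotient) of conjugacy classes of irreducible representations $\rho:\langle a,b\rangle\to \mathrm{GL}(3,\mathbb{C})$ such that $\rho(a),\rho(b),\rho(ab)$ have eigenvalues $\{\lambda_i\},\{\mu_i\},\{\nu_i\}$ respectively. Then there is an irreducible cubic surface $X\subset\mathbb{P}^3$ with at most finitely many singular points, with section $D$ by a plane, such that 1. $X$ is smooth at every point of $D$, and $\mathcal{M}_B$ is isomorphic, as an algebraic variety, to $X\setminus (D\cup \operatorname{Sing}X)$; 2. if the eigenvalues are generic, i.e. $\lambda_i\mu_j\neq\nu_k$ for all $i,j,k$ (equivalently, every representation with these eigenvalues is irreducible), then $X$ is smooth, so that $X$ is a smooth compactification of $\mathcal{M}_B\cong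 X\setminus D$ with boundary divisor $D$; 3. $D$ is a curve of type $I_1$: a reduced, irreducible, rational plane cubic whose only singular point is a node; 4. consequently, the body of the nerve (dual boundary) complex of $D$, which has one vertex for each irreducible component of $D$ and one edge for each node, with its two ends attached to the components containing the two branches at the node, has the homotopy type of $S^1$. In particular 1, 3 and 4 hold for the choice $\{1,\varepsilon,\varepsilon^2\}$, $\varepsilon=e^{2\pi i/3}$, of all three sets of eigenvalues. -/

import Mathlib

open MvPolynomial
open scoped LinearAlgebra.Projectivization Matrix ContinuousMap

noncomputable section

namespace CharVarCompactification

/-! ### Varieties presented as quotients of quasi-affine sets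

`c : Y → (σ → ℂ)` gives the affine coordinates of a set of points `Y`, and `π : Y → V` is a
surjection. A subset of `V` is open when its preimage is Zariski open in `Y`, and a function on an
open subset of `V` is regular when its pull-back to `Y` is regular, that is, locally a quotient of
polynomials in the coordinates. For `Y` an invariant locally closed subset of `ℂⁿ⁺¹ ∖ {0}` and `V`
its image in projective space, this is the usual structure of a quasi-projective variety; for `Y` a
set of representations and `V` its set of conjugacy classes, it is the usual structure on a
geometric quotient. -/

/-- `U ⊆ V` is open in the quotient of the Zariski topology. -/
def ZariskiOpen {σ Y V : Type*} (c : Y → σ → ℂ) (π : Y → V) (U : Set V) : Prop :=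
  ∀ y, π y ∈ U → ∃ q : MvPolynomial σ ℂ, eval (c y) q ≠ 0 ∧ ∀ y', eval (c y') q ≠ 0 → π y' ∈ U

/-- `f` is a regular function on `U ⊆ V` (its values outside `U` are irrelevant). -/
def RegularOn {σ Y V : Type*} (c : Y → σ → ℂ) (π : Y → V) (U : Set V) (f : V → ℂ) : Prop :=
  ∀ y, π y ∈ U → ∃ p q : MvPolynomial σ ℂ, eval (c y) q ≠ 0 ∧
    ∀ y', π y' ∈ U → eval (c y') q ≠ 0 → f (π y') = eval (c y') p / eval (c y') q

/-- The bijection `e` is an isomorphism of varieties: a homeomorphism that identifies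
the sheaves of regular functions. -/
def IsIsoOfVarieties {σ Y V σ' Y' V' : Type*} (c : Y → σ → ℂ) (π : Y → V)
    (c' : Y' → σ' → ℂ) (π' : Y' → V') (e : V ≃ V') : Prop :=
  (∀ U : Set V', ZariskiOpen c' π' U ↔ ZariskiOpen c π (e ⁻¹' U)) ∧
  ∀ U : Set V', ZariskiOpen c' π' U → ∀ f : V' → ℂ,
    RegularOn c' π' U f ↔ RegularOn c π (e ⁻¹' U) (f ∘ e)

/-! ### The character variety of the three-punctured sphere

The fundamental group of the three-punctured sphere is free on the loops `a`, `b` around two of the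
punctures (`0` and `1` in `Fin 2`); the loop around the third one is `(ab)⁻¹`. -/

/-- The fundamental group `⟨a, b⟩` of the three-punctured sphere. -/
abbrev Pi1 : Type := FreeGroup (Fin 2)

/-- The linear representation on `ℂ³` given by a homomorphism to `GL(3, ℂ)`. -/
def toRep (ρ : Pi1 →* GL (Fin 3) ℂ) : Representation ℂ Pi1 (Fin 3 → ℂ) :=
  (Matrix.toLinAlgEquiv' : Matrix (Fin 3) (Fin 3) ℂ ≃ₐ[ℂ] _).toAlgHom.toRingHom.toMonoidHom.comp
    ((Units.coeHom _).comp ρ)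

/-- The eigenvalues of `M`, with multiplicity, are `l 0, l 1, l 2`. -/
def HasEigenvalues (M : GL (Fin 3) ℂ) (l : Fin 3 → ℂ) : Prop :=
  (M : Matrix (Fin 3) (Fin 3) ℂ).charpoly = ∏ i, (Polynomial.X - Polynomial.C (l i))

/-- Irreducible representations with prescribed eigenvalues of `ρ(a)`, `ρ(b)` and `ρ(ab)`. -/
def IrrRep (lam mu nu : Fin 3 → ℂ) : Type :=
  {ρ : Pi1 →* GL (Fin 3) ℂ // (toRep ρ).IsIrreducible ∧
    HasEigenvalues (ρ (FreeGroup.of 0)) lam ∧ HasEigenvalues (ρ (FreeGroup.of 1)) mu ∧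
    HasEigenvalues (ρ (FreeGroup.of 0 * FreeGroup.of 1)) nu}

/-- The affine coordinates of a representation: the entries of `ρ(a)` and `ρ(b)`. -/
def IrrRep.coord {lam mu nu : Fin 3 → ℂ} (ρ : IrrRep lam mu nu) : Fin 2 × Fin 3 × Fin 3 → ℂ :=
  fun k => (ρ.1 (FreeGroup.of k.1) : Matrix (Fin 3) (Fin 3) ℂ) k.2.1 k.2.2

/-- Simultaneous conjugation. -/
def conjSetoid (lam mu nu : Fin 3 → ℂ) : Setoid (IrrRep lam mu nu) where
  r ρ ρ' := ∃ g : GL (Fin 3) ℂ, ∀ x, ρ'.1 x = g * ρ.1 x * g⁻¹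
  iseqv :=
    { refl := fun _ => ⟨1, fun x => by simp⟩
      symm := by
        rintro ρ ρ' ⟨g, hg⟩
        exact ⟨g⁻¹, fun x => by rw [hg x]; group⟩
      trans := by
        rintro ρ ρ' ρ'' ⟨g, hg⟩ ⟨h, hh⟩
        exact ⟨h * g, fun x => by rw [hh x, hg x]; group⟩ }

/-- The character variety: irreducible representations with the given eigenvalues,
up to conjugation. -/
def CharVar (lam mu nu : Fin 3 → ℂ) : Type := Quotient (conjSetoid lam mu nu)

/-- The conjugacy class of a representation. -/
def CharVar.mk {lam mu nu : Fin 3 → ℂ} (ρ : IrrRep lam mu nu) : CharVar lam mu nu :=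
  Quotient.mk (conjSetoid lam mu nu) ρ

/-! ### Projective hypersurfaces -/

/-- The projective hypersurface `F = 0`, for a form `F`. -/
def hypersurface {σ : Type*} (F : MvPolynomial σ ℂ) : Set (ℙ ℂ (σ → ℂ)) :=
  {P | eval P.rep F = 0}

/-- The singular points of the hypersurface `F = 0`. -/
def singularLocus {σ : Type*} (F : MvPolynomial σ ℂ) : Set (ℙ ℂ (σ → ℂ)) :=
  {P | eval P.rep F = 0 ∧ ∀ i, eval P.rep (pderiv i F) = 0}

/-- The points of `F = 0` in the hyperplane at infinity `x₀ = 0`. -/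
def boundary (F : MvPolynomial (Fin 4) ℂ) : Set (ℙ ℂ (Fin 4 → ℂ)) :=
  {P | P ∈ hypersurface F ∧ P.rep 0 = 0}

/-- The equation `F(0, x, y, z)` of the divisor cut out on `F = 0` by the plane at infinity,
as a curve in this plane. -/
def boundaryEquation (F : MvPolynomial (Fin 4) ℂ) : MvPolynomial (Fin 3) ℂ :=
  aeval (Fin.cons 0 X : Fin 4 → MvPolynomial (Fin 3) ℂ) F

/-- The punctured affine cone over a set of points of projective space. -/
def Cone {n : ℕ} (S : Set (ℙ ℂ (Fin n → ℂ))) : Type :=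
  {v : Fin n → ℂ // ∃ h : v ≠ 0, Projectivization.mk ℂ v h ∈ S}

/-- The affine coordinates of a point of the cone. -/
def Cone.coord {n : ℕ} {S : Set (ℙ ℂ (Fin n → ℂ))} (v : Cone S) : Fin n → ℂ := v.1

/-- The projection of the cone to projective space. -/
def Cone.proj {n : ℕ} {S : Set (ℙ ℂ (Fin n → ℂ))} (v : Cone S) : S :=
  ⟨Projectivization.mk ℂ v.1 v.2.choose, v.2.choose_spec⟩

/-- The set of conjugacy classes `CharVar lam mu nu` is isomorphic, as a variety, to the
locally closed subset `S` of projective space. -/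
def CharVarIso (lam mu nu : Fin 3 → ℂ) {n : ℕ} (S : Set (ℙ ℂ (Fin n → ℂ))) : Prop :=
  ∃ e : CharVar lam mu nu ≃ S,
    IsIsoOfVarieties IrrRep.coord CharVar.mk (Cone.coord (S := S)) Cone.proj e

/-! ### Plane curves of type `I₁` -/

/-- The matrix of second derivatives of `G` at `v`. -/
def hessian (G : MvPolynomial (Fin 3) ℂ) (v : Fin 3 → ℂ) : Matrix (Fin 3) (Fin 3) ℂ :=
  Matrix.of fun i j => eval v (pderiv i (pderiv j G))

/-- `P` is a node (ordinary double point) of the plane curve `G = 0`. The vector `P.rep` lies in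
the kernel of the Hessian at a singular point, so rank `2` says that the quadratic term of a local
equation at `P` is nondegenerate. -/
def IsNode (G : MvPolynomial (Fin 3) ℂ) (P : ℙ ℂ (Fin 3 → ℂ)) : Prop :=
  P ∈ singularLocus G ∧ (hessian G P.rep).rank = 2

/-- The plane curve `G = 0` is the image of a morphism from the projective line, given by three
binary forms of the same positive degree without common zero. -/
def IsParametrizedByLine (G : MvPolynomial (Fin 3) ℂ) : Prop :=
  ∃ (d : ℕ) (φ : Fin 3 → MvPolynomial (Fin 2) ℂ), 0 < d ∧ (∀ i, (φ i).IsHomogeneous d) ∧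
    (∀ s : Fin 2 → ℂ, s ≠ 0 → (fun i => eval s (φ i)) ≠ 0) ∧
    ∀ P : ℙ ℂ (Fin 3 → ℂ), P ∈ hypersurface G ↔
      ∃ (s : Fin 2 → ℂ) (h : (fun i => eval s (φ i)) ≠ 0),
        Projectivization.mk ℂ (fun i => eval s (φ i)) h = P

/-- The plane curve `G = 0` is of Kodaira type `I₁`: an irreducible (reduced) rational cubic with a
single singular point, which is a node. -/
structure IsTypeI1 (G : MvPolynomial (Fin 3) ℂ) : Prop where
  cubic : G.IsHomogeneous 3
  irreducible : Irreducible G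
  rational : IsParametrizedByLine G
  node : ∃ P, singularLocus G = {P} ∧ IsNode G P

/-! ### The dual complex of a nodal plane curve

It has a vertex for each irreducible component and an edge for each node. The two ends of the edge
are attached to the components which contain the two branches of the curve at the node (they are
the same component when it crosses itself). The body is built with each edge cut at its midpoint,
one half for each of the two branches. -/

/-- The irreducible components of `G = 0`, given by their prime ideals. -/
def Component (G : MvPolynomial (Fin 3) ℂ) : Type :=
  {I : Ideal (MvPolynomial (Fin 3) ℂ) // I ∈ (Ideal.span {G}).minimalPrimes}

/-- The singular points of `G = 0` (nodes, when the curve is nodal). -/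
def NodePoint (G : MvPolynomial (Fin 3) ℂ) : Type :=
  {P : ℙ ℂ (Fin 3 → ℂ) // P ∈ singularLocus G}

/-- A branch of `G = 0` at a node, given by its tangent line: a line through the node in its
tangent cone. -/
structure Branch (G : MvPolynomial (Fin 3) ℂ) where
  node : NodePoint G
  line : Submodule ℂ (Fin 3 → ℂ)
  finrank_line : Module.finrank ℂ line = 2
  mem_line : node.1.submodule ≤ line
  tangent : ∀ w ∈ line, w ⬝ᵥ (hessian G node.1.rep *ᵥ w) = 0

/-- The branch `b` lies on the component `C`: the component passes through the node, and its
equations vanish to first order along the tangent line of the branch. -/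
def Branch.LiesOn {G : MvPolynomial (Fin 3) ℂ} (b : Branch G) (C : Component G) : Prop :=
  ∀ H ∈ C.1, eval b.node.1.rep H = 0 ∧
    ∀ w ∈ b.line, ∑ i, w i * eval b.node.1.rep (pderiv i H) = 0

instance (G : MvPolynomial (Fin 3) ℂ) : TopologicalSpace (Component G) := ⊥

instance (G : MvPolynomial (Fin 3) ℂ) : TopologicalSpace (NodePoint G) := ⊥

instance (G : MvPolynomial (Fin 3) ℂ) : TopologicalSpace (Branch G) := ⊥

/-- The disjoint union of the vertices, the midpoints of the edges and the half-edges. -/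
abbrev DualCells (G : MvPolynomial (Fin 3) ℂ) : Type :=
  (Component G ⊕ NodePoint G) ⊕ (Branch G × unitInterval)

/-- The half-edge of a branch runs from the midpoint of the edge of its node to the vertex of its
component. -/
inductive DualGlue (G : MvPolynomial (Fin 3) ℂ) : DualCells G → DualCells G → Prop
  | mid (b : Branch G) : DualGlue G (Sum.inr (b, 0)) (Sum.inl (Sum.inr b.node))
  | vert (b : Branch G) (C : Component G) (h : b.LiesOn C) :
      DualGlue G (Sum.inr (b, 1)) (Sum.inl (Sum.inl C))

/-- The body (geometric realization) of the dual complex of the nodal curve `G = 0`. -/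
abbrev DualBody (G : MvPolynomial (Fin 3) ℂ) : Type := Quot (DualGlue G)

end CharVarCompactification

end

/-! Since the `l i` are distinct, ρ(a) can be conjugated to A = diag(l), and what remains is a
matrix B = ρ(b) up to conjugation by diagonal matrices. The torus invariants of B are its diagonal
entries, the three products p_i = B_jk B_kj of opposite entries, and the two 3-cycle products u and
v, with the single relation u v = p_0 p_1 p_2. Prescribing the traces of B and AB leaves one
parameter t for the diagonal; prescribing the two sums of principal 2 × 2 minors leaves one
parameter s for the minors, hence for the p_i; the determinant fixes u + v and leaves one parameter
w. So the invariants lie on the affine surface u v = p_0 p_1 p_2. When u + v is divided suitably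
between u and v, the terms of high degree cancel and this equation is a cubic in t, s, w
(`eval_cubic`).

The pair (A, B) is irreducible iff the graph of nonzero off-diagonal entries of B is strongly
connected, a condition on u, v, p_i alone. On this locus the invariants separate diagonal conjugacy
classes (`exists_diagonal_conj`), and normal forms for B give local sections with regular entries
(`exists_local_realization`). In the other direction t, s, w are traces of words in the spectral
projections of ρ(a) and in ρ(b), so they are regular on the space of representations. Together these
give the isomorphism `charVarIso_smoothAffine`.

The locus that is not strongly connected is exactly the singular locus of the affine surface. There
u, v and two of the p_i vanish, which kills the differential of u v - p_0 p_1 p_2. Conversely, at a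
singular point u = v. The case u = 0 is elementary. If u ≠ 0, Lagrange multipliers give a relation
between B and AB that contradicts the distinctness of their eigenvalues (`not_tangent`). At a
singular point some entry B_kk is an eigenvalue `mu m` and `l k` B_kk is an eigenvalue `nu n`; this
gives finiteness, and emptiness for generic eigenvalues.

At infinity the cubic restricts to a multiple of xyz + D x³ + (∏ l) y³, an irreducible nodal cubic
with D = ∏ mu. Its irreducibility implies that of the surface. Its node has two branches on one
component, so the dual complex is a loop. -/

noncomputable section

namespace CharVarCompactification

/-! ### Zariski neighbourhoods and germs of regular functions -/

/-- `p` holds on a Zariski neighbourhood of `y₀`. -/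
def Near {σ Y : Type*} (c : Y → σ → ℂ) (y₀ : Y) (p : Y → Prop) : Prop :=
  ∃ q : MvPolynomial σ ℂ, eval (c y₀) q ≠ 0 ∧ ∀ y, eval (c y) q ≠ 0 → p y

/-- `g` is regular at `y₀`. -/
def RegAt {σ Y : Type*} (c : Y → σ → ℂ) (y₀ : Y) (g : Y → ℂ) : Prop :=
  ∃ p q : MvPolynomial σ ℂ, eval (c y₀) q ≠ 0 ∧
    ∀ y, eval (c y) q ≠ 0 → g y = eval (c y) p / eval (c y) q

section Germs

variable {σ Y : Type*} {c : Y → σ → ℂ} {y₀ : Y}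

theorem Near.and {p p' : Y → Prop} (h : Near c y₀ p) (h' : Near c y₀ p') :
    Near c y₀ fun y => p y ∧ p' y := by
  obtain ⟨q, hq, H⟩ := h
  obtain ⟨q', hq', H'⟩ := h'
  refine ⟨q * q', by simpa using ⟨hq, hq'⟩, fun y hy => ?_⟩
  rw [map_mul, mul_ne_zero_iff] at hy
  exact ⟨H y hy.1, H' y hy.2⟩

theorem Near.mono {p p' : Y → Prop} (h : Near c y₀ p) (hp : ∀ y, p y → p' y) : Near c y₀ p' := by
  obtain ⟨q, hq, H⟩ := h
  exact ⟨q, hq, fun y hy => hp y (H y hy)⟩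

theorem Near.self {p : Y → Prop} (h : Near c y₀ p) : p y₀ := by
  obtain ⟨q, hq, H⟩ := h
  exact H y₀ hq

theorem RegAt.congr {g g' : Y → ℂ} (h : RegAt c y₀ g) (hg : Near c y₀ fun y => g' y = g y) :
    RegAt c y₀ g' := by
  obtain ⟨p, q, hq, H⟩ := h
  obtain ⟨r, hr, H'⟩ := hg
  refine ⟨p * r, q * r, by simpa using ⟨hq, hr⟩, fun y hy => ?_⟩
  rw [map_mul, mul_ne_zero_iff] at hy
  rw [H' y hy.2, H y hy.1, map_mul, map_mul, mul_div_mul_right _ _ hy.2]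

theorem RegAt.poly (p : MvPolynomial σ ℂ) : RegAt c y₀ fun y => eval (c y) p :=
  ⟨p, 1, by simp, by simp⟩

theorem RegAt.coord (k : σ) : RegAt c y₀ fun y => c y k := by
  simpa using RegAt.poly (c := c) (y₀ := y₀) (X k)

theorem RegAt.const (a : ℂ) : RegAt c y₀ fun _ => a := by
  simpa using RegAt.poly (c := c) (y₀ := y₀) (C a)

theorem RegAt.add {g h : Y → ℂ} (hg : RegAt c y₀ g) (hh : RegAt c y₀ h) :
    RegAt c y₀ fun y => g y + h y := by
  obtain ⟨p, q, hq, H⟩ := hg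
  obtain ⟨p', q', hq', H'⟩ := hh
  refine ⟨p * q' + q * p', q * q', by simpa using ⟨hq, hq'⟩, fun y hy => ?_⟩
  rw [map_mul, mul_ne_zero_iff] at hy
  simp [H y hy.1, H' y hy.2, div_add_div _ _ hy.1 hy.2]

theorem RegAt.mul {g h : Y → ℂ} (hg : RegAt c y₀ g) (hh : RegAt c y₀ h) :
    RegAt c y₀ fun y => g y * h y := by
  obtain ⟨p, q, hq, H⟩ := hg
  obtain ⟨p', q', hq', H'⟩ := hh
  refine ⟨p * p', q * q', by simpa using ⟨hq, hq'⟩, fun y hy => ?_⟩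
  rw [map_mul, mul_ne_zero_iff] at hy
  simp [H y hy.1, H' y hy.2, div_mul_div_comm]

theorem RegAt.neg {g : Y → ℂ} (hg : RegAt c y₀ g) : RegAt c y₀ fun y => -g y := by
  simpa using (RegAt.const (-1)).mul hg

theorem RegAt.sub {g h : Y → ℂ} (hg : RegAt c y₀ g) (hh : RegAt c y₀ h) :
    RegAt c y₀ fun y => g y - h y := by
  simpa [sub_eq_add_neg] using hg.add hh.neg

theorem RegAt.sum {ι : Type*} (s : Finset ι) {g : ι → Y → ℂ} (hg : ∀ i, RegAt c y₀ (g i)) :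
    RegAt c y₀ fun y => ∑ i ∈ s, g i y := by
  classical
  induction s using Finset.induction_on with
  | empty => simpa using RegAt.const 0
  | insert a s ha ih => simpa [Finset.sum_insert ha] using (hg a).add ih

theorem RegAt.near_ne_zero {g : Y → ℂ} (hg : RegAt c y₀ g) (h : g y₀ ≠ 0) :
    Near c y₀ fun y => g y ≠ 0 := by
  obtain ⟨p, q, hq, H⟩ := hg
  have hp : eval (c y₀) p ≠ 0 := fun h0 => h (by simp [H _ hq, h0])
  refine ⟨q * p, by simpa using ⟨hq, hp⟩, fun y hy => ?_⟩
  rw [map_mul, mul_ne_zero_iff] at hy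
  rw [H y hy.1]
  exact div_ne_zero hy.2 hy.1

theorem RegAt.inv {g : Y → ℂ} (hg : RegAt c y₀ g) (h : g y₀ ≠ 0) :
    RegAt c y₀ fun y => (g y)⁻¹ := by
  obtain ⟨p, q, hq, H⟩ := hg
  have hp : eval (c y₀) p ≠ 0 := fun h0 => h (by simp [H _ hq, h0])
  have key : RegAt c y₀ fun y => eval (c y) q / eval (c y) p := ⟨q, p, hp, fun _ _ => rfl⟩
  exact key.congr ⟨q, hq, fun y hy => by simp only [H y hy, inv_div]⟩

theorem RegAt.div {g h : Y → ℂ} (hg : RegAt c y₀ g) (hh : RegAt c y₀ h) (h0 : h y₀ ≠ 0) :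
    RegAt c y₀ fun y => g y / h y := by
  simpa [div_eq_mul_inv] using hg.mul (hh.inv h0)

theorem RegAt.eval {τ : Type*} {Ψ : Y → τ → ℂ} (hΨ : ∀ k, RegAt c y₀ fun y => Ψ y k)
    (q : MvPolynomial τ ℂ) : RegAt c y₀ fun y => MvPolynomial.eval (Ψ y) q := by
  induction q using MvPolynomial.induction_on with
  | C a => simpa using RegAt.const a
  | add p q hp hq => simpa using hp.add hq
  | mul_X p k hp => simpa using hp.mul (hΨ k)

theorem RegAt.matrix_mul {n : ℕ} {M N : Y → Matrix (Fin n) (Fin n) ℂ}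
    (hM : ∀ i j, RegAt c y₀ fun y => M y i j) (hN : ∀ i j, RegAt c y₀ fun y => N y i j)
    (i j : Fin n) : RegAt c y₀ fun y => (M y * N y) i j := by
  simp only [Matrix.mul_apply]
  exact RegAt.sum _ fun k => (hM i k).mul (hN k j)

end Germs

/-- Locally on the source, the map `e` lifts to a map between coverings with regular coordinates. -/
def LocallyLifts {σ Y V σ' Y' V' : Type*} (c : Y → σ → ℂ) (π : Y → V)
    (c' : Y' → σ' → ℂ) (π' : Y' → V') (e : V → V') : Prop :=
  ∀ y₀ : Y, ∃ Ψ : Y → σ' → ℂ, (∀ k, RegAt c y₀ fun y => Ψ y k) ∧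
    Near c y₀ fun y => ∃ y', c' y' = Ψ y ∧ π' y' = e (π y)

/-! ### Pulling back open sets and regular functions along local lifts -/

section Lifts

variable {σ Y V σ' Y' V' : Type*} {c : Y → σ → ℂ} {π : Y → V}
    {c' : Y' → σ' → ℂ} {π' : Y' → V'} {e : V → V'}

theorem LocallyLifts.zariskiOpen (h : LocallyLifts c π c' π' e) {U : Set V'}
    (hU : ZariskiOpen c' π' U) : ZariskiOpen c π (e ⁻¹' U) := by
  intro y₀ hy₀
  obtain ⟨Ψ, hΨ, hn⟩ := h y₀
  obtain ⟨y₁, hy₁, hy₁'⟩ := hn.self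
  obtain ⟨q, hq, H⟩ := hU y₁ (by rw [hy₁']; exact hy₀)
  rw [hy₁] at hq
  refine (hn.and ((RegAt.eval hΨ q).near_ne_zero hq)).mono ?_
  rintro y ⟨⟨y', hy', hy''⟩, hne⟩
  have := H y' (by rwa [hy'])
  rwa [hy''] at this

theorem LocallyLifts.regularOn (h : LocallyLifts c π c' π' e) {U : Set V'} {f : V' → ℂ}
    (hf : RegularOn c' π' U f) : RegularOn c π (e ⁻¹' U) (f ∘ e) := by
  classical
  intro y₀ hy₀
  obtain ⟨Ψ, hΨ, hn⟩ := h y₀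
  obtain ⟨y₁, hy₁, hy₁'⟩ := hn.self
  obtain ⟨p, q, hq, H⟩ := hf y₁ (by rw [hy₁']; exact hy₀)
  rw [hy₁] at hq
  -- Values of `f` off `U` are unconstrained, so they are replaced there by the quotient; the
  -- resulting function is regular at `y₀` in the sense of `RegAt`.
  have hreg : RegAt c y₀ fun y => if e (π y) ∈ U then f (e (π y)) else
      eval (Ψ y) p / eval (Ψ y) q := by
    refine ((RegAt.eval hΨ p).div (RegAt.eval hΨ q) hq).congr
      ((hn.and ((RegAt.eval hΨ q).near_ne_zero hq)).mono ?_)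
    rintro y ⟨⟨y', hy', hy''⟩, hne⟩
    split_ifs with hU
    · rw [← hy'', H y' (by rwa [hy'']) (by rwa [hy']), hy']
    · rfl
  obtain ⟨P, Q, hQ, H'⟩ := hreg
  refine ⟨P, Q, hQ, fun y hy hne => ?_⟩
  exact (if_pos (c := e (π y) ∈ U) hy).symm.trans (H' y hne)

theorem isIsoOfVarieties_of_locallyLifts {e : V ≃ V'} (h : LocallyLifts c π c' π' e)
    (h' : LocallyLifts c' π' c π e.symm) : IsIsoOfVarieties c π c' π' e := by
  refine ⟨fun U => ⟨fun hU => h.zariskiOpen hU, fun hU => ?_⟩,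
    fun U _ f => ⟨fun hf => h.regularOn hf, fun hf => ?_⟩⟩
  · have := h'.zariskiOpen hU
    rwa [← Set.preimage_comp, Equiv.self_comp_symm, Set.preimage_id] at this
  · have := h'.regularOn hf
    rwa [← Set.preimage_comp, Equiv.self_comp_symm, Set.preimage_id, Function.comp_assoc,
      Equiv.self_comp_symm, Function.comp_id] at this

end Lifts

/-! ### Characteristic polynomials and diagonalization of 3 × 3 matrices -/

/-- The second elementary symmetric function of a triple. -/
def esymmTwo (l : Fin 3 → ℂ) : ℂ := l 0 * l 1 + l 1 * l 2 + l 2 * l 0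

/-- The sum of the principal `2 × 2` minors. -/
def minorSum (M : Matrix (Fin 3) (Fin 3) ℂ) : ℂ :=
  (M 0 0 * M 1 1 - M 0 1 * M 1 0) + (M 1 1 * M 2 2 - M 1 2 * M 2 1) +
    (M 2 2 * M 0 0 - M 2 0 * M 0 2)

theorem charpoly_fin_three (M : Matrix (Fin 3) (Fin 3) ℂ) :
    M.charpoly = Polynomial.X ^ 3 - Polynomial.C M.trace * Polynomial.X ^ 2 +
      Polynomial.C (minorSum M) * Polynomial.X - Polynomial.C M.det := by
  rw [Matrix.charpoly, Matrix.det_fin_three, Matrix.det_fin_three, Matrix.trace_fin_three]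
  simp [minorSum]
  ring

theorem prod_X_sub_C_fin_three (l : Fin 3 → ℂ) :
    ∏ i, (Polynomial.X - Polynomial.C (l i)) = Polynomial.X ^ 3 -
      Polynomial.C (∑ i, l i) * Polynomial.X ^ 2 +
      Polynomial.C (esymmTwo l) * Polynomial.X - Polynomial.C (∏ i, l i) := by
  simp [Fin.prod_univ_three, Fin.sum_univ_three, esymmTwo]
  ring

theorem charpoly_eq_prod_iff (M : Matrix (Fin 3) (Fin 3) ℂ) (l : Fin 3 → ℂ) :
    M.charpoly = ∏ i, (Polynomial.X - Polynomial.C (l i)) ↔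
      M.trace = ∑ i, l i ∧ minorSum M = esymmTwo l ∧ M.det = ∏ i, l i := by
  rw [charpoly_fin_three, prod_X_sub_C_fin_three]
  generalize ∑ i, l i = S
  generalize ∏ i, l i = P
  constructor
  · intro h
    have h0 := congrArg (Polynomial.coeff · 0) h
    have h1 := congrArg (Polynomial.coeff · 1) h
    have h2 := congrArg (Polynomial.coeff · 2) h
    simp [Polynomial.coeff_X, Polynomial.coeff_C] at h0 h1 h2
    exact ⟨h2, h1, h0⟩
  · rintro ⟨h0, h1, h2⟩
    rw [h0, h1, h2]

/-- A matrix with distinct eigenvalues is diagonalizable. -/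
theorem exists_mul_eq_mul_diagonal {M : Matrix (Fin 3) (Fin 3) ℂ} {l : Fin 3 → ℂ}
    (hl : Function.Injective l)
    (hM : M.charpoly = ∏ i, (Polynomial.X - Polynomial.C (l i))) :
    ∃ Q : GL (Fin 3) ℂ, M * (Q : Matrix (Fin 3) (Fin 3) ℂ) =
      (Q : Matrix (Fin 3) (Fin 3) ℂ) * Matrix.diagonal l := by
  have hev : ∀ i, ∃ v, Module.End.HasEigenvector (Matrix.toLin' M) (l i) v := by
    intro i
    apply Module.End.HasEigenvalue.exists_hasEigenvector
    rw [Module.End.hasEigenvalue_iff_isRoot_charpoly, Matrix.charpoly_toLin', hM,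
      Polynomial.IsRoot, Polynomial.eval_prod]
    exact Finset.prod_eq_zero (Finset.mem_univ i) (by simp)
  choose v hv using hev
  have hli := Module.End.eigenvectors_linearIndependent' (Matrix.toLin' M) l hl v hv
  let Q : Matrix (Fin 3) (Fin 3) ℂ := Matrix.of fun i j => v j i
  have hQ : IsUnit Q := Matrix.linearIndependent_cols_iff_isUnit.1 hli
  refine ⟨hQ.unit, ?_⟩
  ext i j
  have := congrFun (hv j).apply_eq_smul i
  rw [IsUnit.unit_spec, Matrix.mul_diagonal]
  simpa [Q, Matrix.mul_apply, Matrix.mulVec, dotProduct, mul_comm] using this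

/-- A quadratic polynomial that kills a matrix with three distinct eigenvalues is zero. -/
theorem eq_zero_of_quadratic {M : Matrix (Fin 3) (Fin 3) ℂ} {l : Fin 3 → ℂ}
    (hl : Function.Injective l)
    (hM : M.charpoly = ∏ i, (Polynomial.X - Polynomial.C (l i))) {a b c : ℂ}
    (h : a • (1 : Matrix (Fin 3) (Fin 3) ℂ) + b • M + c • (M * M) = 0) :
    a = 0 ∧ b = 0 ∧ c = 0 := by
  obtain ⟨Q, hQ⟩ := exists_mul_eq_mul_diagonal hl hM
  have key : (Q : Matrix (Fin 3) (Fin 3) ℂ) * (a • (1 : Matrix (Fin 3) (Fin 3) ℂ) +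
      b • Matrix.diagonal l + c • (Matrix.diagonal l * Matrix.diagonal l)) = 0 := by
    have h1 : M * M * (Q : Matrix (Fin 3) (Fin 3) ℂ) =
        (Q : Matrix (Fin 3) (Fin 3) ℂ) * (Matrix.diagonal l * Matrix.diagonal l) := by
      rw [mul_assoc, hQ, ← mul_assoc, hQ, mul_assoc]
    have := congrArg (· * (Q : Matrix (Fin 3) (Fin 3) ℂ)) h
    simp only [add_mul, smul_mul_assoc, one_mul, zero_mul, h1, hQ] at this
    simpa only [mul_add, mul_smul_comm, mul_one] using this
  have key2 : a • (1 : Matrix (Fin 3) (Fin 3) ℂ) +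
      b • Matrix.diagonal l + c • (Matrix.diagonal l * Matrix.diagonal l) = 0 := by
    have := congrArg (((Q⁻¹ : GL (Fin 3) ℂ) : Matrix (Fin 3) (Fin 3) ℂ) * ·) key
    simpa only [← mul_assoc, Units.inv_mul, one_mul, mul_zero] using this
  have e : ∀ i, a + b * l i + c * (l i * l i) = 0 := fun i => by
    simpa using congrFun (congrFun key2 i) i
  have h01 : l 0 - l 1 ≠ 0 := sub_ne_zero.2 fun h => by simpa using hl h
  have h12 : l 1 - l 2 ≠ 0 := sub_ne_zero.2 fun h => by simpa using hl h
  have h02 : l 0 - l 2 ≠ 0 := sub_ne_zero.2 fun h => by simpa using hl h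
  -- Divided differences of the equations `e i`, which invert the Vandermonde system.
  have f1 : b + c * (l 0 + l 1) = 0 :=
    (mul_eq_zero.1 (by linear_combination e 0 - e 1 :
      (l 0 - l 1) * (b + c * (l 0 + l 1)) = 0)).resolve_left h01
  have f2 : b + c * (l 1 + l 2) = 0 :=
    (mul_eq_zero.1 (by linear_combination e 1 - e 2 :
      (l 1 - l 2) * (b + c * (l 1 + l 2)) = 0)).resolve_left h12
  have hc : c = 0 := (mul_eq_zero.1 (by linear_combination f1 - f2 :
      (l 0 - l 2) * c = 0)).resolve_left h02
  have hb : b = 0 := by simpa [hc] using f1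
  exact ⟨by simpa [hb, hc] using e 0, hb, hc⟩

/-! ### Irreducibility of pairs of matrices -/

/-- The pair `(diag, B)` is irreducible when the directed graph of nonzero off-diagonal entries of
`B` is strongly connected. On three vertices this means a `3`-cycle, or two `2`-cycles. -/
def StronglyConnected (B : Matrix (Fin 3) (Fin 3) ℂ) : Prop :=
  ∃ i j k : Fin 3, i ≠ j ∧ j ≠ k ∧ i ≠ k ∧ B i j ≠ 0 ∧ B j k ≠ 0 ∧
    (B k i ≠ 0 ∨ B j i ≠ 0 ∧ B k j ≠ 0)

/-- Two different edges of a triangle share a vertex, so a pair of 2-cycles is determined by its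
middle vertex `i + 1`; the 3-cycles come in two orientations. -/
theorem stronglyConnected_iff (B : Matrix (Fin 3) (Fin 3) ℂ) : StronglyConnected B ↔
    B 0 1 * B 1 2 * B 2 0 ≠ 0 ∨ B 0 2 * B 2 1 * B 1 0 ≠ 0 ∨
      ∃ i : Fin 3, B i (i + 1) * B (i + 1) i ≠ 0 ∧
        B (i + 1) (i + 2) * B (i + 2) (i + 1) ≠ 0 := by
  simp only [mul_ne_zero_iff, StronglyConnected]
  simp only [Fin.exists_fin_succ, Fin.exists_fin_zero]
  simp
  tauto

/-- Otherwise each of the six proper nonempty vertex sets has an edge leaving it, and these edges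
force strong connectivity. -/
theorem exists_invariant_subset {B : Matrix (Fin 3) (Fin 3) ℂ} (h : ¬ StronglyConnected B) :
    ∃ s : Set (Fin 3), s.Nonempty ∧ s ≠ Set.univ ∧ ∀ i j, j ∈ s → i ∉ s → B i j = 0 := by
  by_contra hc
  push Not at hc
  have h0 := hc {0} (by simp) (fun h => by simpa using h.ge (Set.mem_univ (1 : Fin 3)))
  have h1 := hc {1} (by simp) (fun h => by simpa using h.ge (Set.mem_univ (0 : Fin 3)))
  have h2 := hc {2} (by simp) (fun h => by simpa using h.ge (Set.mem_univ (0 : Fin 3)))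
  have h01 := hc {0, 1} (by simp) (fun h => by simpa using h.ge (Set.mem_univ (2 : Fin 3)))
  have h12 := hc {1, 2} (by simp) (fun h => by simpa using h.ge (Set.mem_univ (0 : Fin 3)))
  have h02 := hc {0, 2} (by simp) (fun h => by simpa using h.ge (Set.mem_univ (1 : Fin 3)))
  rw [stronglyConnected_iff] at h
  simp only [mul_ne_zero_iff] at h
  simp only [Fin.exists_fin_succ, Fin.exists_fin_zero] at h h0 h1 h2 h01 h12 h02
  simp at h h0 h1 h2 h01 h12 h02
  grind

theorem toRep_apply (ρ : Pi1 →* GL (Fin 3) ℂ) (g : Pi1) (v : Fin 3 → ℂ) :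
    toRep ρ g v = (ρ g : Matrix (Fin 3) (Fin 3) ℂ) *ᵥ v := rfl

/-- By finite dimension, an injective map that sends `W` into itself is onto `W`. Hence invariance
need only be tested on the generators of the free group, not on their inverses. -/
theorem inv_mulVec_mem {M : GL (Fin 3) ℂ} {W : Submodule ℂ (Fin 3 → ℂ)}
    (h : ∀ v ∈ W, (M : Matrix (Fin 3) (Fin 3) ℂ) *ᵥ v ∈ W) :
    ∀ v ∈ W, ((M⁻¹ : GL (Fin 3) ℂ) : Matrix (Fin 3) (Fin 3) ℂ) *ᵥ v ∈ W := by
  have hinj : Function.Injective (Matrix.mulVecLin (M : Matrix (Fin 3) (Fin 3) ℂ)) := by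
    intro v w hvw
    have := congrArg (((M⁻¹ : GL (Fin 3) ℂ) : Matrix (Fin 3) (Fin 3) ℂ) *ᵥ ·) hvw
    simpa [Matrix.mulVec_mulVec] using this
  have hle : W.map (Matrix.mulVecLin (M : Matrix (Fin 3) (Fin 3) ℂ)) ≤ W := by
    rintro _ ⟨v, hv, rfl⟩
    exact h v hv
  have heq := Submodule.eq_of_le_of_finrank_eq hle (Submodule.equivMapOfInjective _ hinj W).finrank_eq.symm
  intro v hv
  rw [← heq] at hv
  obtain ⟨w, hw, rfl⟩ := hv
  simpa [Matrix.mulVec_mulVec] using hw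

theorem isIrreducible_iff (ρ : Pi1 →* GL (Fin 3) ℂ) : (toRep ρ).IsIrreducible ↔
    ∀ W : Submodule ℂ (Fin 3 → ℂ),
      (∀ x, ∀ v ∈ W, (ρ (FreeGroup.of x) : Matrix (Fin 3) (Fin 3) ℂ) *ᵥ v ∈ W) →
      W = ⊥ ∨ W = ⊤ := by
  constructor
  · intro h W hW
    let S : Subrepresentation (toRep ρ) := ⟨W, fun g => by
      induction g using FreeGroup.induction_on with
      | C1 => intro v hv; simpa [toRep_apply] using hv
      | of x => exact fun v hv => hW x v hv
      | inv_of x _ =>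
        intro v hv
        rw [toRep_apply, map_inv]
        exact inv_mulVec_mem (hW x) v hv
      | mul g g' hg hg' =>
        intro v hv
        have := hg (hg' hv)
        simpa [toRep_apply, Matrix.mulVec_mulVec] using this⟩
    rcases h.eq_bot_or_eq_top S with hS | hS
    · exact Or.inl (congrArg Subrepresentation.toSubmodule hS)
    · exact Or.inr (congrArg Subrepresentation.toSubmodule hS)
  · intro h
    refine { exists_pair_ne := ⟨⊥, ⊤, fun hbt => ?_⟩, eq_bot_or_eq_top := fun S => ?_ }
    · exact bot_ne_top (congrArg Subrepresentation.toSubmodule hbt)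
    · rcases h S.toSubmodule fun x v hv => S.apply_mem_toSubmodule _ hv with hS | hS
      · exact Or.inl (Subrepresentation.toSubmodule_injective hS)
      · exact Or.inr (Subrepresentation.toSubmodule_injective hS)

theorem isIrreducible_conj {ρ ρ' : Pi1 →* GL (Fin 3) ℂ} (g : GL (Fin 3) ℂ)
    (hg : ∀ x, ρ' x = g * ρ x * g⁻¹) (h : (toRep ρ).IsIrreducible) :
    (toRep ρ').IsIrreducible := by
  rw [isIrreducible_iff] at h ⊢
  intro W hW
  have hsurj : Function.Surjective (Matrix.mulVecLin (g : Matrix (Fin 3) (Fin 3) ℂ)) := by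
    intro v
    refine ⟨((g⁻¹ : GL (Fin 3) ℂ) : Matrix (Fin 3) (Fin 3) ℂ) *ᵥ v, ?_⟩
    simp [Matrix.mulVec_mulVec]
  have hmap := Submodule.map_comap_eq_of_surjective hsurj W
  rcases h (W.comap (Matrix.mulVecLin (g : Matrix (Fin 3) (Fin 3) ℂ))) (fun x v hv => by
    have := hW x _ hv
    rw [hg] at this
    simpa [Matrix.mulVec_mulVec, mul_assoc] using this) with h0 | h0
  · left
    rw [← hmap, h0, Submodule.map_bot]
  · right
    rw [← hmap, h0, Submodule.map_top, LinearMap.range_eq_top.2 hsurj]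

/-- Applying (A - l_{i+1})(A - l_{i+2}) to `v` kills the other two coordinates and multiplies the
`i`-th by a nonzero scalar. -/
theorem single_mem_of_diagonal_invariant {l : Fin 3 → ℂ} (hl : Function.Injective l)
    {W : Submodule ℂ (Fin 3 → ℂ)} (hW : ∀ v ∈ W, Matrix.diagonal l *ᵥ v ∈ W) {v : Fin 3 → ℂ}
    (hv : v ∈ W) {i : Fin 3} (hi : v i ≠ 0) : Pi.single i 1 ∈ W := by
  have hsub : ∀ (c : ℂ), ∀ w ∈ W, (fun k => (l k - c) * w k) ∈ W := by
    intro c w hw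
    convert W.sub_mem (hW w hw) (W.smul_mem c hw) using 1
    ext k
    simp [Matrix.mulVec_diagonal, sub_mul]
  have h2 := hsub (l (i + 1)) _ (hsub (l (i + 2)) v hv)
  have h1 : l i - l (i + 1) ≠ 0 := sub_ne_zero.2 fun h => by simpa using hl h
  have h1' : l i - l (i + 2) ≠ 0 := sub_ne_zero.2 fun h => by simpa using hl h
  convert W.smul_mem ((l i - l (i + 1)) * ((l i - l (i + 2)) * v i))⁻¹ h2 using 1
  ext k
  have : k = i ∨ k = i + 1 ∨ k = i + 2 := by
    clear * -
    revert i k; decide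
  rcases this with rfl | rfl | rfl
  · simp only [Pi.single_eq_same, Pi.smul_apply, smul_eq_mul]
    rw [inv_mul_cancel₀]
    exact mul_ne_zero h1 (mul_ne_zero h1' hi)
  · simp
  · simp

/-- Subspaces invariant under a diagonal matrix with distinct entries are coordinate subspaces; one
of them is `B`-invariant iff no edge leaves its set of indices. -/
theorem isIrreducible_iff_stronglyConnected {l : Fin 3 → ℂ} (hl : Function.Injective l)
    {ρ : Pi1 →* GL (Fin 3) ℂ}
    (hρ : (ρ (FreeGroup.of 0) : Matrix (Fin 3) (Fin 3) ℂ) = Matrix.diagonal l) :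
    (toRep ρ).IsIrreducible ↔
      StronglyConnected (ρ (FreeGroup.of 1) : Matrix (Fin 3) (Fin 3) ℂ) := by
  rw [isIrreducible_iff]
  set B := (ρ (FreeGroup.of 1) : Matrix (Fin 3) (Fin 3) ℂ) with hB
  simp only [Fin.forall_fin_two, hρ, ← hB]
  constructor
  · intro h
    by_contra hc
    obtain ⟨s, ⟨j, hj⟩, hs, hBs⟩ := exists_invariant_subset hc
    obtain ⟨i, hi⟩ := (Set.ne_univ_iff_exists_notMem s).1 hs
    -- The vectors supported on `s`.
    let W : Submodule ℂ (Fin 3 → ℂ) := Submodule.pi sᶜ fun _ => ⊥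
    have hmem : ∀ v, v ∈ W ↔ ∀ k, k ∉ s → v k = 0 := fun v => by
      simp [W, Submodule.mem_pi]
    have hdiag : ∀ v ∈ W, Matrix.diagonal l *ᵥ v ∈ W := by
      intro v hv
      rw [hmem] at hv ⊢
      intro k hk
      simp [Matrix.mulVec_diagonal, hv k hk]
    have hBW : ∀ v ∈ W, B *ᵥ v ∈ W := by
      intro v hv
      rw [hmem] at hv ⊢
      intro k hk
      rw [Matrix.mulVec_eq_sum]
      simp only [Finset.sum_apply]
      refine Finset.sum_eq_zero fun m _ => ?_
      by_cases hm : m ∈ s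
      · simp [hBs k m hm hk]
      · simp [hv m hm]
    rcases h W ⟨hdiag, hBW⟩ with h0 | h0
    · have : (Pi.single j 1 : Fin 3 → ℂ) ∈ W := by
        rw [hmem]
        intro k hk
        exact Pi.single_eq_of_ne (fun h => hk (by rwa [h])) 1
      rw [h0, Submodule.mem_bot] at this
      simpa using congrFun this j
    · have : (Pi.single i 1 : Fin 3 → ℂ) ∈ W := by rw [h0]; trivial
      simpa using (hmem _).1 this i hi
  · rintro ⟨i, j, k, hij, hjk, hik, h1, h2, h3⟩ W ⟨hA, hW⟩
    by_cases hbot : W = ⊥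
    · exact Or.inl hbot
    right
    obtain ⟨v, hv, hv0⟩ := W.ne_bot_iff.1 hbot
    obtain ⟨m, hm⟩ := Function.ne_iff.1 hv0
    have hstart := single_mem_of_diagonal_invariant hl hA hv hm
    have hstep : ∀ p q, B p q ≠ 0 → (Pi.single q 1 : Fin 3 → ℂ) ∈ W →
        (Pi.single p 1 : Fin 3 → ℂ) ∈ W := fun p q hpq hq =>
      single_mem_of_diagonal_invariant hl hA (hW _ hq) (by simpa using hpq)
    have hall : (Pi.single i 1 : Fin 3 → ℂ) ∈ W ∧ (Pi.single j 1 : Fin 3 → ℂ) ∈ W ∧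
        (Pi.single k 1 : Fin 3 → ℂ) ∈ W := by
      have hm' : m = i ∨ m = j ∨ m = k := by
        clear * - hij hjk hik
        revert i j k m; decide
      have hji := hstep i j h1
      have hkj := hstep j k h2
      have hback : (Pi.single i 1 : Fin 3 → ℂ) ∈ W → (Pi.single k 1 : Fin 3 → ℂ) ∈ W := by
        rcases h3 with h3 | ⟨h3, h4⟩
        · exact hstep k i h3
        · exact fun h => hstep k j h4 (hstep j i h3 h)
      rcases hm' with rfl | rfl | rfl <;> tauto
    rw [eq_top_iff]
    intro w _
    have : w = ∑ p, w p • (Pi.single p 1 : Fin 3 → ℂ) := by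
      ext q
      simp [Finset.sum_apply, Pi.single_apply]
    rw [this]
    refine W.sum_mem fun p _ => W.smul_mem _ ?_
    have hp : p = i ∨ p = j ∨ p = k := by
      clear * - hij hjk hik
      revert i j k p; decide
    rcases hp with rfl | rfl | rfl
    exacts [hall.1, hall.2.1, hall.2.2]

/-- Two matrices with nonvanishing cyclic products that agree are conjugate by a diagonal
matrix. -/
theorem exists_diagonal_conj {B B' : Matrix (Fin 3) (Fin 3) ℂ} (hB : StronglyConnected B)
    (h1 : ∀ i, B i i = B' i i) (h2 : ∀ i j, B i j * B j i = B' i j * B' j i)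
    (h3 : ∀ i j k, B i j * B j k * B k i = B' i j * B' j k * B' k i) :
    ∃ g : Fin 3 → ℂ, (∀ i, g i ≠ 0) ∧ ∀ i j, g i * B i j = B' i j * g j := by
  obtain ⟨i, j, k, hij, hjk, hik, hBij, hBjk, hor⟩ := hB
  have hB' : B' i j ≠ 0 ∧ B' j k ≠ 0 := by
    rcases hor with h | ⟨h, h'⟩
    · have := mul_ne_zero (mul_ne_zero hBij hBjk) h
      rw [h3] at this
      exact ⟨left_ne_zero_of_mul (left_ne_zero_of_mul this),
        right_ne_zero_of_mul (left_ne_zero_of_mul this)⟩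
    · have e1 := mul_ne_zero hBij h
      have e2 := mul_ne_zero hBjk h'
      rw [h2] at e1 e2
      exact ⟨left_ne_zero_of_mul e1, left_ne_zero_of_mul e2⟩
  obtain ⟨hB'ij, hB'jk⟩ := hB'
  -- Normalized to 1 at `i`, the conjugator is forced along the path i → j → k.
  obtain ⟨g, gi, gj, gk⟩ : ∃ g : Fin 3 → ℂ, g i = 1 ∧ g j = B i j / B' i j ∧
      g k = B i j / B' i j * (B j k / B' j k) :=
    ⟨fun m => if m = i then 1 else if m = j then B i j / B' i j else
      B i j / B' i j * (B j k / B' j k), by simp, by simp [hij.symm], by simp [hik.symm, hjk.symm]⟩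
  have gj0 : g j ≠ 0 := by rw [gj]; exact div_ne_zero hBij hB'ij
  have eij : g i * B i j = B' i j * g j := by rw [gi, gj]; field_simp
  have ejk : g j * B j k = B' j k * g k := by rw [gj, gk]; field_simp
  have eji : g j * B j i = B' j i * g i := by
    rw [gi, gj, div_mul_eq_mul_div, h2]; field_simp
  have ekj : g k * B k j = B' k j * g j := by
    have := h2 j k
    rw [gj, gk]; field_simp; linear_combination this
  have eki : g k * B k i = B' k i * g i := by
    have := h3 i j k
    rw [gi, gk]; field_simp; linear_combination this
  -- This entry is off the path: it is recovered from the 2-cycle on `i`, `k` if `B k i ≠ 0`, and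
  -- otherwise from the 3-cycle through `k`, `j`.
  have eik : g i * B i k = B' i k * g k := by
    rw [gi, one_mul]
    rw [gi, mul_one] at eji eki
    rcases hor with h | ⟨h, h'⟩
    · refine mul_right_cancel₀ h ?_
      linear_combination h2 i k - B' i k * eki
    · refine mul_right_cancel₀ (mul_ne_zero h' h) ?_
      refine mul_right_cancel₀ gj0 ?_
      linear_combination g j * h3 i k j - B' i k * B' j i * ekj - B' i k * g k * B k j * eji
  have hcases : ∀ m, m = i ∨ m = j ∨ m = k := by
    clear * - hij hjk hik
    revert i j k; decide
  refine ⟨g, fun m => ?_, fun m n => ?_⟩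
  · rcases hcases m with rfl | rfl | rfl
    · simp [gi]
    · exact gj0
    · rw [gk]
      exact mul_ne_zero (div_ne_zero hBij hB'ij) (div_ne_zero hBjk hB'jk)
  · rcases hcases m with rfl | rfl | rfl <;> rcases hcases n with rfl | rfl | rfl <;>
      first | assumption | rw [h1, mul_comm]

/-! ### The cubic surface

In coordinates `(t, s, w)`, a pair `(diag l, B)` with prescribed characteristic polynomials has
diagonal entries `diagEntry`, principal minors `diagMinor`, products `B i j * B j i` of opposite
entries `pairProd`, and cyclic products `cycleA`, `cycleB`. -/

section Cubic

/-- The differences `l 1 - l 2`, `l 2 - l 0`, `l 0 - l 1`. -/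
def gap (l : Fin 3 → ℂ) (i : Fin 3) : ℂ := l (i + 1) - l (i + 2)

theorem gap_ne_zero {l : Fin 3 → ℂ} (hl : Function.Injective l) (i : Fin 3) : gap l i ≠ 0 :=
  sub_ne_zero.2 fun h => by simpa using hl h

variable (l β γ : Fin 3 → ℂ) (D t s w : ℂ)

/-- The diagonal entry `B i i`. -/
def diagEntry (i : Fin 3) : ℂ := gap l i * (β i + t)

/-- The principal minor of `B` complementary to the index `i`. -/
def diagMinor (i : Fin 3) : ℂ := l i * gap l i * (γ i + s)

/-- The product `B j k * B k j`, where `i`, `j`, `k` are distinct. -/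
def pairProd (i : Fin 3) : ℂ :=
  diagEntry l β t (i + 1) * diagEntry l β t (i + 2) - diagMinor l γ s i

/-- The cyclic product `B 0 1 * B 1 2 * B 2 0`. -/
def cycleA : ℂ :=
  w - ∑ i, l (i + 1) * l i * gap l i * (β i + t) * (γ i + s) + ∏ i, diagEntry l β t i

/-- The cyclic product `B 0 2 * B 2 1 * B 1 0`. -/
def cycleB : ℂ :=
  D - w + ∑ i, l (i + 2) * l i * gap l i * (β i + t) * (γ i + s) + ∏ i, diagEntry l β t i

/-- The equation of the compactified character variety. -/
def cubic : MvPolynomial (Fin 4) ℂ :=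
  X 0 * X 3 * (C D * X 0 - X 3) +
  X 3 * ∑ i, C ((l (i + 1) + l (i + 2)) * l i * gap l i) *
    ((C (β i) * X 0 + X 1) * (C (γ i) * X 0 + X 2)) -
  C D * X 0 * ∑ i, C (l (i + 1) * l i * gap l i) *
    ((C (β i) * X 0 + X 1) * (C (γ i) * X 0 + X 2)) -
  C (∏ i, l i) * X 0 *
    (C (∑ i, l i * gap l i * γ i) * X 1 + C (∑ i, l i * gap l i * β i) * X 2 +
      C (∑ i, l i * gap l i * β i * γ i) * X 0) *
    (C (∑ i, gap l i * γ i) * X 1 + C (∑ i, gap l i * β i) * X 2 +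
      C (∑ i, gap l i * β i * γ i) * X 0) +
  C (∏ i, l i * gap l i) * ∏ i, (C (γ i) * X 0 + X 2) +
  C (D * ∏ i, gap l i) * ∏ i, (C (β i) * X 0 + X 1)

theorem cubic_isHomogeneous : (cubic l β γ D).IsHomogeneous 3 := by
  have hX : ∀ i, (X i : MvPolynomial (Fin 4) ℂ).IsHomogeneous 1 := isHomogeneous_X ℂ
  have hC : ∀ (a : ℂ) i, (C a * X i : MvPolynomial (Fin 4) ℂ).IsHomogeneous 1 :=
    fun a i => (hX i).C_mul a
  have hy : ∀ i, (C (β i) * X 0 + X 1 : MvPolynomial (Fin 4) ℂ).IsHomogeneous 1 :=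
    fun i => (hC _ _).add (hX 1)
  have hz : ∀ i, (C (γ i) * X 0 + X 2 : MvPolynomial (Fin 4) ℂ).IsHomogeneous 1 :=
    fun i => (hC _ _).add (hX 2)
  have hq : ∀ f : Fin 3 → ℂ, (∑ i, C (f i) * ((C (β i) * X 0 + X 1) * (C (γ i) * X 0 + X 2)) :
      MvPolynomial (Fin 4) ℂ).IsHomogeneous 2 :=
    fun f => IsHomogeneous.sum _ _ _ fun i _ => ((hy i).mul (hz i)).C_mul _
  have hlin : ∀ a b c : ℂ, (C a * X 1 + C b * X 2 + C c * X 0 :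
      MvPolynomial (Fin 4) ℂ).IsHomogeneous 1 :=
    fun a b c => ((hC a 1).add (hC b 2)).add (hC c 0)
  have hprod : ∀ f : Fin 3 → MvPolynomial (Fin 4) ℂ, (∀ i, (f i).IsHomogeneous 1) →
      (∏ i, f i).IsHomogeneous 3 := fun f hf => by
    simpa using IsHomogeneous.prod Finset.univ f (fun _ => 1) fun i _ => hf i
  exact ((((((hX 0).mul (hX 3)).mul ((hC D 0).sub (hX 3))).add ((hX 3).mul (hq _))).sub
    ((hC D 0).mul (hq _))).sub (((hC _ 0).mul (hlin _ _ _)).mul (hlin _ _ _))).add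
    ((hprod _ hz).C_mul _) |>.add ((hprod _ hy).C_mul _)

theorem sum_mul_gap_mul (a : ℂ) : ∑ i, l i * gap l i * β i = ∑ i, l i * gap l i * (β i + a) := by
  simp [gap, Fin.sum_univ_three]
  ring

theorem sum_gap_mul (a : ℂ) : ∑ i, gap l i * β i = ∑ i, gap l i * (β i + a) := by
  simp [gap, Fin.sum_univ_three]
  ring

/-- The `t * s` term cancels because ∑ l_i gap_i = 0. This and the analogous fact ∑ gap_i = 0 below
lower the degree of the equation to 3. -/
theorem sum_mul_gap_mul_mul :
    (∑ i, l i * gap l i * γ i) * t + (∑ i, l i * gap l i * β i) * s +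
      ∑ i, l i * gap l i * β i * γ i = ∑ i, l i * gap l i * ((β i + t) * (γ i + s)) := by
  simp [gap, Fin.sum_univ_three]
  ring

theorem sum_gap_mul_mul :
    (∑ i, gap l i * γ i) * t + (∑ i, gap l i * β i) * s +
      ∑ i, gap l i * β i * γ i = ∑ i, gap l i * ((β i + t) * (γ i + s)) := by
  simp [gap, Fin.sum_univ_three]
  ring

/-- Write d_i for the diagonal entries, m_i for the minors, y_i = β_i + t, z_i = γ_i + s. In u v - ∏
(d_j d_k - m_i) the terms (∏ d)² and (∏ d) ∑ d_i m_i cancel. The remaining terms of degree 4 in y, z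
combine to -(∏ l)(∑ l_i gap_i y_i z_i)(∑ gap_i y_i z_i), in which both sums are affine in (t, s). -/
theorem eval_cubic : eval ![1, t, s, w] (cubic l β γ D) =
    cycleA l β γ t s w * cycleB l β γ D t s w - ∏ i, pairProd l β γ t s i := by
  simp [cubic]
  rw [sum_mul_gap_mul_mul, sum_gap_mul_mul]
  simp [cycleA, cycleB, pairProd, diagEntry, diagMinor, Fin.sum_univ_three, Fin.prod_univ_three]
  generalize β 0 + t = y0, β 1 + t = y1, β 2 + t = y2, γ 0 + s = z0, γ 1 + s = z1, γ 2 + s = z2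
  simp [gap]
  ring

theorem eval_pderiv_three_cubic : eval ![1, t, s, w] (pderiv 3 (cubic l β γ D)) =
    cycleB l β γ D t s w - cycleA l β γ t s w := by
  simp [cubic, pderiv_X, Fin.prod_univ_three]
  simp [cycleA, cycleB, Fin.sum_univ_three, Fin.prod_univ_three]
  ring

/-- The product rule for `cycleA * cycleB - ∏ pairProd`: the first two sums are the `t`-derivatives
of `cycleA` and `cycleB`. -/
theorem eval_pderiv_one_cubic : eval ![1, t, s, w] (pderiv 1 (cubic l β γ D)) =
    (∑ i, gap l i * (diagEntry l β t (i + 1) * diagEntry l β t (i + 2) -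
      l (i + 1) * l i * (γ i + s))) * cycleB l β γ D t s w +
    (∑ i, gap l i * (diagEntry l β t (i + 1) * diagEntry l β t (i + 2) +
      l (i + 2) * l i * (γ i + s))) * cycleA l β γ t s w -
    ∑ i, (gap l (i + 1) * diagEntry l β t (i + 2) + diagEntry l β t (i + 1) * gap l (i + 2)) *
      (pairProd l β γ t s (i + 1) * pairProd l β γ t s (i + 2)) := by
  simp [cubic, pderiv_X, Fin.prod_univ_three]
  rw [sum_mul_gap_mul_mul, sum_gap_mul_mul, sum_mul_gap_mul l γ s, sum_gap_mul l γ s]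
  simp [cycleA, cycleB, pairProd, diagEntry, diagMinor, Fin.sum_univ_three, Fin.prod_univ_three]
  generalize β 0 + t = y0, β 1 + t = y1, β 2 + t = y2, γ 0 + s = z0, γ 1 + s = z1, γ 2 + s = z2
  simp [gap]
  ring

theorem eval_pderiv_two_cubic : eval ![1, t, s, w] (pderiv 2 (cubic l β γ D)) =
    -(∑ i, l (i + 1) * l i * diagEntry l β t i) * cycleB l β γ D t s w +
    (∑ i, l (i + 2) * l i * diagEntry l β t i) * cycleA l β γ t s w +
    ∑ i, l i * gap l i * (pairProd l β γ t s (i + 1) * pairProd l β γ t s (i + 2)) := by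
  simp [cubic, pderiv_X, Fin.prod_univ_three]
  rw [sum_mul_gap_mul_mul, sum_gap_mul_mul, sum_mul_gap_mul l β t, sum_gap_mul l β t]
  simp [cycleA, cycleB, pairProd, diagEntry, diagMinor, Fin.sum_univ_three, Fin.prod_univ_three]
  generalize β 0 + t = y0, β 1 + t = y1, β 2 + t = y2, γ 0 + s = z0, γ 1 + s = z1, γ 2 + s = z2
  simp [gap]
  ring

end Cubic

/-- The orthogonal complement of `gap l` is the plane spanned by `1` and `l`; the coefficients are
found by interpolation at `l 1`, `l 2`. -/
theorem exists_eq_add_mul_of_sum_gap {l x : Fin 3 → ℂ} (hl : Function.Injective l)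
    (h : ∑ i, gap l i * x i = 0) : ∃ a b, ∀ i, x i = a + b * l i := by
  have h0 : l 1 - l 2 ≠ 0 := gap_ne_zero hl 0
  simp [Fin.sum_univ_three, gap] at h
  refine ⟨x 1 - (x 1 - x 2) / (l 1 - l 2) * l 1, (x 1 - x 2) / (l 1 - l 2), fun i => ?_⟩
  fin_cases i
  · simp
    field_simp
    linear_combination h
  · simp
  · simp
    field_simp
    ring

/-- The preceding lemma for l_i x_i, divided by l_i: the inverse of l_i is proportional to l_{i+1}
l_{i+2}. -/
theorem exists_eq_add_mul_of_sum_mul_gap {l x : Fin 3 → ℂ} (hl : Function.Injective l)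
    (hl0 : ∀ i, l i ≠ 0) (h : ∑ i, l i * gap l i * x i = 0) :
    ∃ a b, ∀ i, x i = a + b * (l (i + 1) * l (i + 2)) := by
  obtain ⟨b, a, hab⟩ := exists_eq_add_mul_of_sum_gap hl (x := fun i => l i * x i)
    (by simpa only [mul_assoc, mul_left_comm] using h)
  refine ⟨a, b / (l 0 * l 1 * l 2), fun i => mul_left_cancel₀ (hl0 i) ?_⟩
  have := hl0 0
  have := hl0 1
  have := hl0 2
  rw [hab i]
  fin_cases i <;> simp <;> field_simp <;> ring

/-- If both cyclic products of `B` agree and do not vanish, then `B` is diagonally conjugate to a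
symmetric matrix, and the differential of the determinant at this matrix does not vanish on the
symmetric deformations that fix the trace and the sum of principal minors of `B` and of
`diag l * B`. -/
theorem not_tangent {l mu nu h : Fin 3 → ℂ} (hl : Function.Injective l)
    (hmu : Function.Injective mu) (hnu : Function.Injective nu)
    (hl0 : ∀ i, l i ≠ 0) (hmu0 : ∀ i, mu i ≠ 0) {B : Matrix (Fin 3) (Fin 3) ℂ}
    (hB : B.charpoly = ∏ i, (Polynomial.X - Polynomial.C (mu i)))
    (hAB : (Matrix.diagonal l * B).charpoly = ∏ i, (Polynomial.X - Polynomial.C (nu i)))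
    (hsymm : B 0 1 * B 1 2 * B 2 0 = B 0 2 * B 2 1 * B 1 0) (hne : B 0 1 * B 1 2 * B 2 0 ≠ 0)
    (hh : ∀ i, B 0 1 * B 1 2 * B 2 0 =
      B (i + 1) (i + 2) * B (i + 2) (i + 1) * (B i i + h i))
    (h1 : ∑ i, l i * gap l i * h i = 0)
    (h2 : ∑ i, gap l i * (B (i + 1) (i + 1) * B (i + 2) (i + 2) -
      B (i + 1) (i + 2) * B (i + 2) (i + 1) + (h (i + 1) * B (i + 2) (i + 2) +
        h (i + 2) * B (i + 1) (i + 1))) = 0) : False := by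
  obtain ⟨b, d, hbd⟩ := exists_eq_add_mul_of_sum_mul_gap hl hl0 h1
  obtain ⟨a', c', hac⟩ := exists_eq_add_mul_of_sum_gap hl h2
  have hne' := hne
  rw [hsymm] at hne'
  simp only [mul_ne_zero_iff] at hne hne'
  obtain ⟨⟨n01, n12⟩, n20⟩ := hne
  obtain ⟨⟨n02, n21⟩, n10⟩ := hne'
  have hh0 := hh 0
  have hh1 := hh 1
  have hh2 := hh 2
  have hbd0 := hbd 0
  have hbd1 := hbd 1
  have hbd2 := hbd 2
  have hac0 := hac 0
  have hac1 := hac 1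
  have hac2 := hac 2
  simp at hh0 hh1 hh2 hbd0 hbd1 hbd2 hac0 hac1 hac2
  set S := B 0 0 + B 1 1 + B 2 2 with hS
  set T := l 0 * B 0 0 + l 1 * B 1 1 + l 2 * B 2 2 with hT
  obtain ⟨a, ha⟩ : ∃ a, a = a' - b * S := ⟨_, rfl⟩
  obtain ⟨c, hc⟩ : ∃ c, c = c' - d * T := ⟨_, rfl⟩
  -- The Lagrange multiplier equation: the adjugate is the gradient of det, and 1, A, B, ABA come
  -- from the traces of B, AB, B², (AB)². Off the diagonal, equality of the two cycles makes the
  -- adjugate entry equal to h_i B_jk, with h_i = b + d l_j l_k.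
  have hadj : B.adjugate = a • (1 : Matrix (Fin 3) (Fin 3) ℂ) + c • Matrix.diagonal l + b • B +
      d • (Matrix.diagonal l * B * Matrix.diagonal l) := by
    rw [Matrix.adjugate_fin_three]
    ext i j
    fin_cases i <;> fin_cases j <;> simp
    · linear_combination hac0 - B 2 2 * hbd1 - B 1 1 * hbd2 - ha - l 0 * hc - b * hS - d * l 0 * hT
    · refine mul_right_cancel₀ n10 ?_
      linear_combination hh2 - hsymm + B 0 1 * B 1 0 * hbd2
    · refine mul_right_cancel₀ n20 ?_
      linear_combination hh1 + B 0 2 * B 2 0 * hbd1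
    · refine mul_right_cancel₀ n01 ?_
      linear_combination hh2 + B 0 1 * B 1 0 * hbd2
    · linear_combination hac1 - B 2 2 * hbd0 - B 0 0 * hbd2 - ha - l 1 * hc - b * hS - d * l 1 * hT
    · refine mul_right_cancel₀ n21 ?_
      linear_combination hh0 - hsymm + B 1 2 * B 2 1 * hbd0
    · refine mul_right_cancel₀ n02 ?_
      linear_combination hh1 - hsymm + B 0 2 * B 2 0 * hbd1
    · refine mul_right_cancel₀ n12 ?_
      linear_combination hh0 + B 1 2 * B 2 1 * hbd0
    · linear_combination hac2 - B 1 1 * hbd0 - B 0 0 * hbd1 - ha - l 2 * hc - b * hS - d * l 2 * hT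
  have hdet : B.det ≠ 0 := by
    rw [((charpoly_eq_prod_iff B mu).1 hB).2.2]
    exact Finset.prod_ne_zero_iff.2 fun i _ => hmu0 i
  set A := Matrix.diagonal l with hA
  -- Multiplying the multiplier equation by B writes K both as a polynomial in B and as one in AB.
  -- So K commutes with B and AB, hence with A, and is scalar.
  set K := a • B + b • (B * B) with hK
  have hKC : K = B.det • (1 : Matrix (Fin 3) (Fin 3) ℂ) - c • (A * B) - d • ((A * B) * (A * B)) := by
    have := Matrix.adjugate_mul B
    rw [hadj] at this
    simp only [add_mul, smul_mul_assoc, one_mul] at this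
    rw [← this, hK]
    simp only [mul_assoc]
    abel
  have hBK : B * K = K * B := by
    simp only [hK, mul_add, add_mul, mul_smul_comm, smul_mul_assoc, mul_assoc]
  have hCK : (A * B) * K = K * (A * B) := by
    rw [hKC]
    simp only [mul_sub, sub_mul, mul_smul_comm, smul_mul_assoc, mul_assoc, mul_one, one_mul]
  have hAK : A * K = K * A := by
    have hu : IsUnit B := (Matrix.isUnit_iff_isUnit_det B).2 (isUnit_iff_ne_zero.2 hdet)
    refine hu.mul_left_injective ?_
    simp only
    rw [mul_assoc, ← hBK, ← mul_assoc, hCK, mul_assoc]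
  have hoff : ∀ i j, i ≠ j → K i j = 0 := by
    intro i j hij
    have := congrFun (congrFun hAK i) j
    rw [hA, Matrix.diagonal_mul, Matrix.mul_diagonal] at this
    have hlij : l i - l j ≠ 0 := sub_ne_zero.2 fun h => hij (hl h)
    exact (mul_eq_zero.1 (by linear_combination this : (l i - l j) * K i j = 0)).resolve_left hlij
  have hdiag : ∀ i j, B i j ≠ 0 → K i i = K j j := by
    intro i j hij
    have := congrFun (congrFun hBK i) j
    rw [Matrix.mul_apply, Matrix.mul_apply, Finset.sum_eq_single j, Finset.sum_eq_single i] at this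
    · exact mul_right_cancel₀ hij (by rw [← this, mul_comm])
    · intro k _ hk
      rw [hoff i k hk.symm, zero_mul]
    · simp
    · intro k _ hk
      rw [hoff k j hk, mul_zero]
    · simp
  have hscal : K = K 0 0 • (1 : Matrix (Fin 3) (Fin 3) ℂ) := by
    have e1 := hdiag 1 0 n10
    have e2 := hdiag 2 0 n20
    ext i j
    by_cases hij : i = j
    · subst hij
      fin_cases i <;> simp [e1, e2]
    · simp [hoff i j hij, hij]
  -- Distinct eigenvalues of B make its quadratic relation trivial, so K = 0; then distinct
  -- eigenvalues of AB force det B = 0.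
  have hz := eq_zero_of_quadratic hmu hB (a := -K 0 0) (b := a) (c := b) (by
    rw [add_assoc, ← hK, neg_smul, ← hscal, neg_add_cancel])
  have hK0 : K 0 0 = 0 := neg_eq_zero.1 hz.1
  have hz' := eq_zero_of_quadratic hnu hAB (a := B.det) (b := -c) (c := -d) (by
    rw [neg_smul, neg_smul, ← sub_eq_add_neg, ← sub_eq_add_neg, ← hKC, hscal, hK0, zero_smul])
  exact hdet hz'.1

/-! ### Matrices realizing a point of the surface -/

/-- The constants `β`, `γ` are adapted to the eigenvalues: `diagEntry` and `diagMinor` have the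
traces and sums of minors that the characteristic polynomials prescribe. -/
structure Adapted (l mu nu β γ : Fin 3 → ℂ) : Prop where
  trace : ∑ i, gap l i * β i = ∑ i, mu i
  trace_mul : ∑ i, l i * gap l i * β i = ∑ i, nu i
  minors : ∑ i, l i * gap l i * γ i = esymmTwo mu
  minors_mul : (∏ i, l i) * ∑ i, gap l i * γ i = esymmTwo nu

theorem exists_sum_gap_mul {l : Fin 3 → ℂ} (hl : Function.Injective l) (a b : ℂ) :
    ∃ x : Fin 3 → ℂ, ∑ i, gap l i * x i = a ∧ ∑ i, l i * gap l i * x i = b := by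
  have h0 : l 2 - l 0 ≠ 0 := gap_ne_zero hl 1
  have h1 : l 1 - l 2 ≠ 0 := gap_ne_zero hl 0
  have h2 : l 0 - l 1 ≠ 0 := gap_ne_zero hl 2
  refine ⟨![0, (b - l 2 * a) / ((l 2 - l 0) * (l 1 - l 2)),
    (l 1 * a - b) / ((l 0 - l 1) * (l 1 - l 2))], ?_, ?_⟩
  · simp [Fin.sum_univ_three, gap]
    field_simp
    ring
  · simp [Fin.sum_univ_three, gap]
    field_simp
    ring

theorem exists_adapted {l : Fin 3 → ℂ} (hl : Function.Injective l) (hl0 : ∀ i, l i ≠ 0)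
    (mu nu : Fin 3 → ℂ) : ∃ β γ, Adapted l mu nu β γ := by
  obtain ⟨β, h1, h2⟩ := exists_sum_gap_mul hl (∑ i, mu i) (∑ i, nu i)
  obtain ⟨γ, h3, h4⟩ := exists_sum_gap_mul hl (esymmTwo nu / ∏ i, l i) (esymmTwo mu)
  exact ⟨β, γ, h1, h2, h4, by
    rw [h3, mul_div_cancel₀ _ (Finset.prod_ne_zero_iff.2 fun i _ => hl0 i)]⟩

/-- The invariants of `B` under diagonal conjugation are given by the point `(t, s, w)`. -/
structure Realizes (l β γ : Fin 3 → ℂ) (D t s w : ℂ) (B : Matrix (Fin 3) (Fin 3) ℂ) : Prop where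
  diag : ∀ i, B i i = diagEntry l β t i
  pair : ∀ i, B (i + 1) (i + 2) * B (i + 2) (i + 1) = pairProd l β γ t s i
  cycA : B 0 1 * B 1 2 * B 2 0 = cycleA l β γ t s w
  cycB : B 0 2 * B 2 1 * B 1 0 = cycleB l β γ D t s w

/-- The condition on a point that the pairs which realize it are irreducible. -/
def Connected (l β γ : Fin 3 → ℂ) (D t s w : ℂ) : Prop :=
  cycleA l β γ t s w ≠ 0 ∨ cycleB l β γ D t s w ≠ 0 ∨
    ∃ i, pairProd l β γ t s (i + 2) ≠ 0 ∧ pairProd l β γ t s i ≠ 0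

variable {l mu nu β γ : Fin 3 → ℂ} {D t s w : ℂ}

theorem Realizes.stronglyConnected_iff {B : Matrix (Fin 3) (Fin 3) ℂ}
    (h : Realizes l β γ D t s w B) : StronglyConnected B ↔ Connected l β γ D t s w := by
  rw [CharVarCompactification.stronglyConnected_iff, Connected, h.cycA, h.cycB]
  -- `pairProd` is indexed by the vertex opposite to the edge.
  have e : ∀ i, B i (i + 1) * B (i + 1) i = pairProd l β γ t s (i + 2) := fun i => by
    rw [← h.pair (i + 2)]
    fin_cases i <;> rfl
  simp only [e, h.pair]

theorem Realizes.charpoly (ha : Adapted l mu nu β γ) {B : Matrix (Fin 3) (Fin 3) ℂ}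
    (h : Realizes l β γ (∏ i, mu i) t s w B) :
    B.charpoly = ∏ i, (Polynomial.X - Polynomial.C (mu i)) := by
  have d0 := h.diag 0
  have d1 := h.diag 1
  have d2 := h.diag 2
  have p0 := h.pair 0
  have p1 := h.pair 1
  have p2 := h.pair 2
  have cA := h.cycA
  have cB := h.cycB
  have a1 := ha.trace
  have a2 := ha.minors
  simp [pairProd, diagEntry, diagMinor, cycleA, cycleB, Fin.sum_univ_three,
    Fin.prod_univ_three] at d0 d1 d2 p0 p1 p2 cA cB a1 a2
  rw [charpoly_eq_prod_iff, Matrix.trace_fin_three, Matrix.det_fin_three, minorSum]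
  simp only [Fin.sum_univ_three, Fin.prod_univ_three]
  refine ⟨?_, ?_, ?_⟩
  · rw [d0, d1, d2, ← a1]
    simp [gap]
    ring
  · rw [d0, d1, d2, ← a2]
    simp [gap] at p0 p1 p2 ⊢
    linear_combination - p0 - p1 - p2
  · have key : B 0 0 * B 1 1 * B 2 2 - B 0 0 * B 1 2 * B 2 1 - B 0 1 * B 1 0 * B 2 2 +
        B 0 1 * B 1 2 * B 2 0 + B 0 2 * B 1 0 * B 2 1 - B 0 2 * B 1 1 * B 2 0 =
        B 0 0 * B 1 1 * B 2 2 - B 0 0 * (B 1 2 * B 2 1) - B 1 1 * (B 2 0 * B 0 2) -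
        B 2 2 * (B 0 1 * B 1 0) + B 0 1 * B 1 2 * B 2 0 + B 0 2 * B 2 1 * B 1 0 := by ring
    rw [key, cA, cB, p0, p1, p2, d0, d1, d2]
    simp [gap]
    ring

/-- Left multiplication by diag l scales the minor opposite to `i` by l_j l_k, turning its factor
l_i gap_i into (∏ l) gap_i; hence `s` drops out of the sum. -/
theorem Realizes.charpoly_mul (ha : Adapted l mu nu β γ)
    (hdet : (∏ i, l i) * ∏ i, mu i = ∏ i, nu i) {B : Matrix (Fin 3) (Fin 3) ℂ}
    (h : Realizes l β γ (∏ i, mu i) t s w B) :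
    (Matrix.diagonal l * B).charpoly = ∏ i, (Polynomial.X - Polynomial.C (nu i)) := by
  have hB := ((charpoly_eq_prod_iff _ _).1 (h.charpoly ha)).2.2
  have d0 := h.diag 0
  have d1 := h.diag 1
  have d2 := h.diag 2
  have p0 := h.pair 0
  have p1 := h.pair 1
  have p2 := h.pair 2
  have a1 := ha.trace_mul
  have a2 := ha.minors_mul
  simp [pairProd, diagEntry, diagMinor, Fin.sum_univ_three,
    Fin.prod_univ_three] at d0 d1 d2 p0 p1 p2 a1 a2
  rw [charpoly_eq_prod_iff, Matrix.trace_fin_three, Matrix.det_mul, Matrix.det_diagonal, hB, hdet,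
    minorSum]
  simp only [Fin.sum_univ_three, Matrix.diagonal_mul]
  refine ⟨?_, ?_, trivial⟩
  · rw [d0, d1, d2, ← a1]
    simp [gap]
    ring
  · rw [d0, d1, d2, ← a2]
    simp [gap] at p0 p1 p2 ⊢
    linear_combination - l 1 * l 2 * p0 - l 2 * l 0 * p1 - l 0 * l 1 * p2

/-- A matrix with the prescribed characteristic polynomials realizes a point of the surface. -/
theorem exists_realizes (hl : Function.Injective l) (hl0 : ∀ i, l i ≠ 0)
    (ha : Adapted l mu nu β γ) {B : Matrix (Fin 3) (Fin 3) ℂ}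
    (hB : B.charpoly = ∏ i, (Polynomial.X - Polynomial.C (mu i)))
    (hAB : (Matrix.diagonal l * B).charpoly = ∏ i, (Polynomial.X - Polynomial.C (nu i))) :
    ∃ t s w, Realizes l β γ (∏ i, mu i) t s w B := by
  have hg := gap_ne_zero hl
  rw [charpoly_eq_prod_iff, Matrix.trace_fin_three, minorSum] at hB hAB
  obtain ⟨hB1, hB2, hB3⟩ := hB
  obtain ⟨hC1, hC2, -⟩ := hAB
  rw [← ha.trace] at hB1
  rw [← ha.trace_mul] at hC1
  rw [← ha.minors] at hB2
  rw [← ha.minors_mul] at hC2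
  simp only [Matrix.diagonal_mul, Fin.sum_univ_three, Fin.prod_univ_three] at hB1 hB2 hC1 hC2
  -- The two linear conditions have the constants as only solutions, because ∑ l_i² gap_i = -∏ gap_i
  -- ≠ 0. This gives one parameter for the diagonal and one for the minors.
  have huniq : ∀ x : Fin 3 → ℂ, ∑ i, gap l i * x i = 0 → ∑ i, l i * gap l i * x i = 0 →
      ∀ i, x i = x 0 := by
    intro x h1 h2
    obtain ⟨a, b, hab⟩ := exists_eq_add_mul_of_sum_gap hl h1
    have hV : gap l 0 * gap l 1 * gap l 2 ≠ 0 :=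
      mul_ne_zero (mul_ne_zero (hg 0) (hg 1)) (hg 2)
    have hb : b = 0 := by
      refine (mul_eq_zero.1 (?_ : gap l 0 * gap l 1 * gap l 2 * b = 0)).resolve_left hV
      simp [-mul_eq_zero, hab, Fin.sum_univ_three, gap] at h2 ⊢
      linear_combination -h2
    simp [hab, hb]
  obtain ⟨x, hx⟩ : ∃ x : Fin 3 → ℂ, ∀ i, B i i = gap l i * (β i + x i) :=
    ⟨fun i => B i i / gap l i - β i, fun i => by
      have := hg i
      field_simp
      ring⟩
  obtain ⟨z, hz⟩ : ∃ z : Fin 3 → ℂ, ∀ i, B (i + 1) (i + 1) * B (i + 2) (i + 2) -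
      B (i + 1) (i + 2) * B (i + 2) (i + 1) = l i * gap l i * (γ i + z i) :=
    ⟨fun i => (B (i + 1) (i + 1) * B (i + 2) (i + 2) -
      B (i + 1) (i + 2) * B (i + 2) (i + 1)) / (l i * gap l i) - γ i, fun i => by
      have := hg i
      have := hl0 i
      field_simp
      ring⟩
  have hx' := huniq x (by
    rw [Fin.sum_univ_three]
    linear_combination hB1 - hx 0 - hx 1 - hx 2) (by
    rw [Fin.sum_univ_three]
    linear_combination hC1 - l 0 * hx 0 - l 1 * hx 1 - l 2 * hx 2)
  have z0 := hz 0
  have z1 := hz 1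
  have z2 := hz 2
  simp at z0 z1 z2
  have hz' := huniq z (by
    rw [Fin.sum_univ_three]
    have h0 := hl0 0
    have h1 := hl0 1
    have h2 := hl0 2
    refine mul_left_cancel₀ (mul_ne_zero (mul_ne_zero h0 h1) h2) ?_
    linear_combination hC2 - l 1 * l 2 * z0 - l 2 * l 0 * z1 - l 0 * l 1 * z2) (by
    rw [Fin.sum_univ_three]
    linear_combination hB2 - z0 - z1 - z2)
  have hd : ∀ i, B i i = diagEntry l β (x 0) i := fun i => by rw [hx, hx' i, diagEntry]
  have hp : ∀ i, B (i + 1) (i + 2) * B (i + 2) (i + 1) = pairProd l β γ (x 0) (z 0) i := by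
    intro i
    rw [pairProd, ← hd, ← hd, diagMinor, ← hz' i, ← hz]
    ring
  -- `w` is solved from the formula for `cycleA`; the formula for `cycleB` is then the determinant
  -- condition.
  refine ⟨x 0, z 0, B 0 1 * B 1 2 * B 2 0 +
    ∑ i, l (i + 1) * l i * gap l i * (β i + x 0) * (γ i + z 0) - ∏ i, diagEntry l β (x 0) i,
    hd, hp, by rw [cycleA]; ring, ?_⟩
  rw [cycleB, ← hB3, Matrix.det_fin_three]
  have d0 := hd 0
  have d1 := hd 1
  have d2 := hd 2
  have p0 := hp 0
  have p1 := hp 1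
  have p2 := hp 2
  simp [pairProd, diagEntry, diagMinor] at d0 d1 d2 p0 p1 p2
  have key : B 0 0 * B 1 1 * B 2 2 - B 0 0 * B 1 2 * B 2 1 - B 0 1 * B 1 0 * B 2 2 +
        B 0 1 * B 1 2 * B 2 0 + B 0 2 * B 1 0 * B 2 1 - B 0 2 * B 1 1 * B 2 0 =
        B 0 0 * B 1 1 * B 2 2 - B 0 0 * (B 1 2 * B 2 1) - B 1 1 * (B 2 0 * B 0 2) -
        B 2 2 * (B 0 1 * B 1 0) + B 0 1 * B 1 2 * B 2 0 + B 0 2 * B 2 1 * B 1 0 := by ring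
  rw [key, p0, p1, p2, d0, d1, d2]
  simp [Fin.sum_univ_three, Fin.prod_univ_three, diagEntry, gap]
  ring

/-! ### Singular points -/

theorem Realizes.cycleA_mul_cycleB {B : Matrix (Fin 3) (Fin 3) ℂ}
    (h : Realizes l β γ D t s w B) :
    cycleA l β γ t s w * cycleB l β γ D t s w = ∏ i, pairProd l β γ t s i := by
  rw [← h.cycA, ← h.cycB, Fin.prod_univ_three, ← h.pair, ← h.pair, ← h.pair]
  simp
  ring

theorem eval_cubic_eq_zero_iff : eval ![1, t, s, w] (cubic l β γ D) = 0 ↔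
    cycleA l β γ t s w * cycleB l β γ D t s w = ∏ i, pairProd l β γ t s i := by
  rw [eval_cubic, sub_eq_zero]

/-- Every term of the differential of u v - p_0 p_1 p_2 contains u, v or a product of two of the
p_i, and all of these vanish. -/
theorem singular_of_not_connected (h : ¬ Connected l β γ D t s w) :
    ∀ i ∈ ({1, 2, 3} : Set (Fin 4)), eval ![1, t, s, w] (pderiv i (cubic l β γ D)) = 0 := by
  simp only [Connected, not_or, not_not, not_exists, not_and_or] at h
  obtain ⟨hA, hB, hp⟩ := h
  have hpp : ∀ i, pairProd l β γ t s (i + 1) * pairProd l β γ t s (i + 2) = 0 := by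
    intro i
    rcases hp (i + 2) with h | h
    · have : i + 2 + 2 = i + 1 := by clear * -; revert i; decide
      rw [this] at h
      rw [h, zero_mul]
    · rw [h, mul_zero]
  rintro i (rfl | rfl | rfl)
  · rw [eval_pderiv_one_cubic, hA, hB]
    simp [hpp]
  · rw [eval_pderiv_two_cubic, hA, hB]
    simp [hpp]
  · rw [eval_pderiv_three_cubic, hA, hB, sub_zero]

/-- The `w`-derivative v - u gives u = v. If u ≠ 0, all p_i are nonzero, a realizing matrix exists,
and the other two derivatives are the hypotheses of `not_tangent`. If u = 0, some p_i vanishes and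
the `s`-derivative forces a second one to vanish. -/
theorem not_connected_of_singular (hl : Function.Injective l)
    (hmu : Function.Injective mu) (hnu : Function.Injective nu)
    (hl0 : ∀ i, l i ≠ 0) (hmu0 : ∀ i, mu i ≠ 0) (hdet : (∏ i, l i) * ∏ i, mu i = ∏ i, nu i)
    (ha : Adapted l mu nu β γ) (h0 : eval ![1, t, s, w] (cubic l β γ (∏ i, mu i)) = 0)
    (h : ∀ i ∈ ({1, 2, 3} : Set (Fin 4)),
      eval ![1, t, s, w] (pderiv i (cubic l β γ (∏ i, mu i))) = 0) :
    ¬ Connected l β γ (∏ i, mu i) t s w := by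
  have h1 := h 1 (by simp)
  have h2 := h 2 (by simp)
  have h3 := h 3 (by simp)
  rw [eval_pderiv_one_cubic] at h1
  rw [eval_pderiv_two_cubic] at h2
  rw [eval_pderiv_three_cubic, sub_eq_zero] at h3
  rw [eval_cubic_eq_zero_iff, h3, Fin.prod_univ_three] at h0
  rw [h3] at h1 h2
  have hu : cycleA l β γ t s w = 0 := by
    by_contra hne
    set u := cycleA l β γ t s w with hu
    have hprod : pairProd l β γ t s 0 * pairProd l β γ t s 1 * pairProd l β γ t s 2 ≠ 0 :=
      h0 ▸ mul_ne_zero hne hne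
    have hp1 := right_ne_zero_of_mul (left_ne_zero_of_mul hprod)
    have hp0 := left_ne_zero_of_mul (left_ne_zero_of_mul hprod)
    have hp2 := right_ne_zero_of_mul hprod
    obtain ⟨B, hB⟩ : ∃ B, Realizes l β γ (∏ i, mu i) t s w B := by
      refine ⟨!![diagEntry l β t 0, 1, pairProd l β γ t s 1 / u;
        pairProd l β γ t s 2, diagEntry l β t 1, 1;
        u, pairProd l β γ t s 0, diagEntry l β t 2], ?_, ?_, ?_, ?_⟩
      · intro i
        fin_cases i <;> rfl
      · intro i
        fin_cases i <;> simp
        field_simp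
      · simp [hu]
      · rw [h3]
        simp
        field_simp
        linear_combination -h0
    -- With this `h`, the surface equation gives p_j p_k = u (d_i + h_i), which makes the
    -- derivatives linear in `h` after division by u.
    obtain ⟨h, hh⟩ : ∃ h : Fin 3 → ℂ, ∀ i, u = pairProd l β γ t s i * (diagEntry l β t i + h i) := by
      have hpi : ∀ i, pairProd l β γ t s i ≠ 0 := by
        intro i
        fin_cases i <;> assumption
      exact ⟨fun i => u / pairProd l β γ t s i - diagEntry l β t i, fun i => by
        have := hpi i
        field_simp
        ring⟩
    have hpp0 : pairProd l β γ t s 1 * pairProd l β γ t s 2 = u * (diagEntry l β t 0 + h 0) := by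
      refine mul_left_cancel₀ hp0 ?_
      linear_combination -h0 + u * hh 0
    have hpp1 : pairProd l β γ t s 2 * pairProd l β γ t s 0 = u * (diagEntry l β t 1 + h 1) := by
      refine mul_left_cancel₀ hp1 ?_
      linear_combination -h0 + u * hh 1
    have hpp2 : pairProd l β γ t s 0 * pairProd l β γ t s 1 = u * (diagEntry l β t 2 + h 2) := by
      refine mul_left_cancel₀ hp2 ?_
      linear_combination -h0 + u * hh 2
    simp [Fin.sum_univ_three] at h1 h2
    rw [hpp0, hpp1, hpp2] at h1 h2
    refine not_tangent (h := h) hl hmu hnu hl0 hmu0 (hB.charpoly ha) (hB.charpoly_mul ha hdet)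
      (by rw [hB.cycA, hB.cycB, h3]) (by rwa [hB.cycA]) (fun i => ?_) ?_ ?_
    · rw [hB.cycA, hB.pair, hB.diag]
      exact hh i
    · refine mul_left_cancel₀ hne ?_
      rw [Fin.sum_univ_three]
      simp [-mul_eq_zero, gap] at h2 ⊢
      linear_combination h2
    · refine mul_left_cancel₀ hne ?_
      simp only [hB.pair, hB.diag, Fin.sum_univ_three]
      simp [-mul_eq_zero, pairProd, diagMinor, gap] at h1 ⊢
      linear_combination -h1
  have hv : cycleB l β γ (∏ i, mu i) t s w = 0 := h3.trans hu
  simp [hu, Fin.sum_univ_three] at h2 h0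
  have hg : ∀ i, l i * gap l i ≠ 0 := fun i => mul_ne_zero (hl0 i) (gap_ne_zero hl i)
  have g0 := hg 0
  have g1 := hg 1
  have g2 := hg 2
  simp only [Connected, hu, hv, ne_eq, not_true_eq_false, false_or]
  rintro ⟨i, hi, hi'⟩
  fin_cases i
  · simp at hi hi'
    have : pairProd l β γ t s 1 = 0 := by simpa [hi, hi'] using h0
    simp [this, g1, hi, hi'] at h2
  · simp at hi hi'
    have : pairProd l β γ t s 2 = 0 := by simpa [hi, hi'] using h0
    simp [this, g2, hi, hi'] at h2
  · simp at hi hi'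
    have : pairProd l β γ t s 0 = 0 := by simpa [hi, hi'] using h0
    simp [this, g0, hi, hi'] at h2

/-! ### Points of projective hypersurfaces -/

section Projective

variable {n d : ℕ} {F : MvPolynomial (Fin n) ℂ}

theorem eval_smul_of_isHomogeneous (hF : F.IsHomogeneous d) (a : ℂ) (v : Fin n → ℂ) :
    eval (a • v) F = a ^ d * eval v F := by
  rw [eval_eq, eval_eq, Finset.mul_sum]
  refine Finset.sum_congr rfl fun e he => ?_
  have hdeg : e.degree = d := by
    by_contra h
    exact mem_support_iff.1 he (hF.coeff_eq_zero h)
  simp only [Pi.smul_apply, smul_eq_mul, mul_pow, Finset.prod_mul_distrib, Finset.prod_pow_eq_pow_sum]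
  rw [show ∑ i ∈ e.support, e i = d from hdeg]
  ring

theorem eval_smul_eq_zero_iff (hF : F.IsHomogeneous d) {a : ℂ} (ha : a ≠ 0) (v : Fin n → ℂ) :
    eval (a • v) F = 0 ↔ eval v F = 0 := by
  rw [eval_smul_of_isHomogeneous hF, mul_eq_zero, or_iff_right (pow_ne_zero _ ha)]

/-- Loci are defined through the chosen representative `rep`; with homogeneity this allows testing
on any nonzero vector. -/
theorem exists_rep_eq_smul {v : Fin n → ℂ} (hv : v ≠ 0) :
    ∃ a : ℂ, a ≠ 0 ∧ (Projectivization.mk ℂ v hv).rep = a • v := by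
  obtain ⟨a, ha⟩ := Projectivization.exists_smul_eq_mk_rep ℂ v hv
  exact ⟨a, a.ne_zero, ha.symm⟩

theorem mk_mem_hypersurface_iff (hF : F.IsHomogeneous d) {v : Fin n → ℂ} (hv : v ≠ 0) :
    Projectivization.mk ℂ v hv ∈ hypersurface F ↔ eval v F = 0 := by
  obtain ⟨a, ha, h⟩ := exists_rep_eq_smul hv
  rw [hypersurface, Set.mem_ofPred_eq, h, eval_smul_eq_zero_iff hF ha]

theorem mk_mem_singularLocus_iff (hF : F.IsHomogeneous d) {v : Fin n → ℂ} (hv : v ≠ 0) :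
    Projectivization.mk ℂ v hv ∈ singularLocus F ↔
      eval v F = 0 ∧ ∀ i, eval v (pderiv i F) = 0 := by
  obtain ⟨a, ha, h⟩ := exists_rep_eq_smul hv
  rw [singularLocus, Set.mem_ofPred_eq, h, eval_smul_eq_zero_iff hF ha]
  simp only [eval_smul_eq_zero_iff hF.pderiv ha]

theorem mk_mem_boundary_iff {F : MvPolynomial (Fin 4) ℂ} (hF : F.IsHomogeneous d)
    {v : Fin 4 → ℂ} (hv : v ≠ 0) :
    Projectivization.mk ℂ v hv ∈ boundary F ↔ eval v F = 0 ∧ v 0 = 0 := by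
  obtain ⟨a, ha, h⟩ := exists_rep_eq_smul hv
  rw [boundary, Set.mem_ofPred_eq, mk_mem_hypersurface_iff hF, h]
  simp [ha]

theorem affine_ne_zero (t s w : ℂ) : (![1, t, s, w] : Fin 4 → ℂ) ≠ 0 :=
  fun h => one_ne_zero (congrFun h 0)

theorem eq_smul_affine {v : Fin 4 → ℂ} (h0 : v 0 ≠ 0) :
    v = v 0 • ![1, v 1 / v 0, v 2 / v 0, v 3 / v 0] := by
  ext i
  fin_cases i <;> simp <;> field_simp

theorem mk_eq_mk_affine {v : Fin 4 → ℂ} (hv : v ≠ 0) (h0 : v 0 ≠ 0) :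
    Projectivization.mk ℂ v hv =
      Projectivization.mk ℂ ![1, v 1 / v 0, v 2 / v 0, v 3 / v 0] (affine_ne_zero _ _ _) :=
  (Projectivization.mk_eq_mk_iff' ℂ _ _ _ _).2 ⟨v 0, (eq_smul_affine h0).symm⟩

theorem mk_affine_inj {t s w t' s' w' : ℂ}
    (h : Projectivization.mk ℂ ![1, t, s, w] (affine_ne_zero _ _ _) =
      Projectivization.mk ℂ ![1, t', s', w'] (affine_ne_zero _ _ _)) :
    t = t' ∧ s = s' ∧ w = w' := by
  obtain ⟨a, ha⟩ := (Projectivization.mk_eq_mk_iff' ℂ _ _ _ _).1 h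
  have h0 := congrFun ha 0
  have h1 := congrFun ha 1
  have h2 := congrFun ha 2
  have h3 := congrFun ha 3
  simp at h0
  simp [h0] at h1 h2 h3
  exact ⟨h1.symm, h2.symm, h3.symm⟩

end Projective

/-! ### The smooth affine part of the cubic surface -/

section Smooth

variable {l mu nu β γ : Fin 3 → ℂ}

/-- The part of the cubic surface that parametrizes irreducible representations. -/
abbrev smoothAffine (F : MvPolynomial (Fin 4) ℂ) : Set (ℙ ℂ (Fin 4 → ℂ)) :=
  hypersurface F \ (boundary F ∪ singularLocus F)

theorem mk_affine_mem_singularLocus_iff (hl : Function.Injective l)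
    (hmu : Function.Injective mu) (hnu : Function.Injective nu)
    (hl0 : ∀ i, l i ≠ 0) (hmu0 : ∀ i, mu i ≠ 0) (hdet : (∏ i, l i) * ∏ i, mu i = ∏ i, nu i)
    (ha : Adapted l mu nu β γ) (t s w : ℂ) :
    Projectivization.mk ℂ ![1, t, s, w] (affine_ne_zero t s w) ∈
        singularLocus (cubic l β γ (∏ i, mu i)) ↔
      eval ![1, t, s, w] (cubic l β γ (∏ i, mu i)) = 0 ∧
        ¬ Connected l β γ (∏ i, mu i) t s w := by
  have hF := cubic_isHomogeneous l β γ (∏ i, mu i)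
  rw [mk_mem_singularLocus_iff hF]
  refine and_congr_right fun h0 => ⟨fun h => ?_, fun h => ?_⟩
  · exact not_connected_of_singular hl hmu hnu hl0 hmu0 hdet ha h0 fun i _ => h i
  · have hs := singular_of_not_connected h
    have h1 := hs 1 (by simp)
    have h2 := hs 2 (by simp)
    have h3 := hs 3 (by simp)
    -- Euler's identity at x₀ = 1 yields the remaining derivative.
    have he := congrArg (eval ![1, t, s, w]) hF.sum_X_mul_pderiv
    rw [Fin.sum_univ_four] at he
    simp [h0, h1, h2, h3] at he
    intro i
    have hi : i = 0 ∨ i = 1 ∨ i = 2 ∨ i = 3 := by clear * -; revert i; decide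
    rcases hi with rfl | rfl | rfl | rfl
    exacts [he, h1, h2, h3]

theorem mk_mem_smoothAffine_iff (hl : Function.Injective l)
    (hmu : Function.Injective mu) (hnu : Function.Injective nu)
    (hl0 : ∀ i, l i ≠ 0) (hmu0 : ∀ i, mu i ≠ 0) (hdet : (∏ i, l i) * ∏ i, mu i = ∏ i, nu i)
    (ha : Adapted l mu nu β γ) {v : Fin 4 → ℂ} (hv : v ≠ 0) :
    Projectivization.mk ℂ v hv ∈ smoothAffine (cubic l β γ (∏ i, mu i)) ↔
      v 0 ≠ 0 ∧
      eval ![1, v 1 / v 0, v 2 / v 0, v 3 / v 0] (cubic l β γ (∏ i, mu i)) = 0 ∧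
      Connected l β γ (∏ i, mu i) (v 1 / v 0) (v 2 / v 0) (v 3 / v 0) := by
  have hF := cubic_isHomogeneous l β γ (∏ i, mu i)
  by_cases h0 : v 0 = 0
  · simp only [smoothAffine, Set.mem_sdiff, Set.mem_union, mk_mem_boundary_iff hF,
      mk_mem_hypersurface_iff hF, h0]
    tauto
  · rw [mk_eq_mk_affine hv h0]
    simp only [smoothAffine, Set.mem_sdiff, Set.mem_union, mk_mem_boundary_iff hF,
      mk_mem_hypersurface_iff hF,
      mk_affine_mem_singularLocus_iff hl hmu hnu hl0 hmu0 hdet ha, Matrix.cons_val_zero,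
      one_ne_zero, and_false, false_or, ne_eq, h0, not_false_eq_true, true_and]
    generalize Connected _ _ _ _ _ _ _ = P, (eval _ _ = 0) = Q
    tauto

end Smooth

/-! ### Local sections -/

section Sections

variable {l β γ : Fin 3 → ℂ} {D : ℂ} {σ Y : Type*} {c : Y → σ → ℂ} {y₀ : Y} {t s w : Y → ℂ}

theorem regAt_diagEntry (ht : RegAt c y₀ t) (i : Fin 3) :
    RegAt c y₀ fun y => diagEntry l β (t y) i :=
  (RegAt.const _).mul ((RegAt.const _).add ht)

theorem regAt_pairProd (ht : RegAt c y₀ t) (hs : RegAt c y₀ s) (i : Fin 3) :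
    RegAt c y₀ fun y => pairProd l β γ (t y) (s y) i :=
  ((regAt_diagEntry ht _).mul (regAt_diagEntry ht _)).sub
    ((RegAt.const _).mul ((RegAt.const _).add hs))

theorem regAt_sum_aux (ht : RegAt c y₀ t) (hs : RegAt c y₀ s) (f : Fin 3 → ℂ) :
    RegAt c y₀ fun y => ∑ i, f i * (β i + t y) * (γ i + s y) :=
  RegAt.sum _ fun _ => ((RegAt.const _).mul ((RegAt.const _).add ht)).mul ((RegAt.const _).add hs)

theorem regAt_prod_diagEntry (ht : RegAt c y₀ t) :
    RegAt c y₀ fun y => ∏ i, diagEntry l β (t y) i := by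
  simp only [Fin.prod_univ_three]
  exact ((regAt_diagEntry ht _).mul (regAt_diagEntry ht _)).mul (regAt_diagEntry ht _)

theorem regAt_cycleA (ht : RegAt c y₀ t) (hs : RegAt c y₀ s) (hw : RegAt c y₀ w) :
    RegAt c y₀ fun y => cycleA l β γ (t y) (s y) (w y) :=
  (hw.sub (regAt_sum_aux ht hs _)).add (regAt_prod_diagEntry ht)

theorem regAt_cycleB (ht : RegAt c y₀ t) (hs : RegAt c y₀ s) (hw : RegAt c y₀ w) :
    RegAt c y₀ fun y => cycleB l β γ D (t y) (s y) (w y) :=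
  (((RegAt.const _).sub hw).add (regAt_sum_aux ht hs _)).add (regAt_prod_diagEntry ht)

/-- Near a point with irreducible representations, the points of the surface are realized by
matrices with regular entries. -/
theorem exists_local_realization (ht : RegAt c y₀ t) (hs : RegAt c y₀ s) (hw : RegAt c y₀ w)
    (hF : ∀ y, cycleA l β γ (t y) (s y) (w y) * cycleB l β γ D (t y) (s y) (w y) =
      ∏ i, pairProd l β γ (t y) (s y) i)
    (h : Connected l β γ D (t y₀) (s y₀) (w y₀)) :
    ∃ B : Y → Matrix (Fin 3) (Fin 3) ℂ, (∀ i j, RegAt c y₀ fun y => B y i j) ∧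
      Near c y₀ fun y => Realizes l β γ D (t y) (s y) (w y) (B y) := by
  have hb := fun i => regAt_diagEntry (l := l) (β := β) ht i
  have hp := fun i => regAt_pairProd (l := l) (β := β) (γ := γ) ht hs i
  have hA := regAt_cycleA (l := l) (β := β) (γ := γ) ht hs hw
  have hB := regAt_cycleB (l := l) (β := β) (γ := γ) (D := D) ht hs hw
  have h1 : RegAt c y₀ fun _ => 1 := RegAt.const 1
  simp only [Fin.prod_univ_three] at hF
  -- In each chart two entries along a path are normalized to 1, and the others are read off from
  -- the invariants. The only denominator is `cycleA`, `cycleB`, or the product of two nonzero pair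
  -- products.
  rcases h with hne | hne | ⟨i, hne, hne'⟩
  · refine ⟨fun y => !![diagEntry l β (t y) 0, 1,
        pairProd l β γ (t y) (s y) 1 / cycleA l β γ (t y) (s y) (w y);
      pairProd l β γ (t y) (s y) 2, diagEntry l β (t y) 1, 1;
      cycleA l β γ (t y) (s y) (w y), pairProd l β γ (t y) (s y) 0, diagEntry l β (t y) 2], ?_,
      (hA.near_ne_zero hne).mono fun y hy => ⟨?_, ?_, ?_, ?_⟩⟩
    · intro i j
      have := (hp 1).div hA hne
      fin_cases i <;> fin_cases j <;> first | exact h1 | exact hb _ | exact hp _ | assumption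
    · intro i
      fin_cases i <;> rfl
    · intro i
      fin_cases i <;> simp
      field_simp
    · simp
    · simp
      field_simp
      linear_combination - hF y
  · refine ⟨fun y => !![diagEntry l β (t y) 0,
        pairProd l β γ (t y) (s y) 2 / cycleB l β γ D (t y) (s y) (w y), 1;
      cycleB l β γ D (t y) (s y) (w y), diagEntry l β (t y) 1, pairProd l β γ (t y) (s y) 0;
      pairProd l β γ (t y) (s y) 1, 1, diagEntry l β (t y) 2], ?_,
      (hB.near_ne_zero hne).mono fun y hy => ⟨?_, ?_, ?_, ?_⟩⟩
    · intro i j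
      have := (hp 2).div hB hne
      fin_cases i <;> fin_cases j <;> first | exact h1 | exact hb _ | exact hp _ | assumption
    · intro i
      fin_cases i <;> rfl
    · intro i
      fin_cases i <;> simp
      field_simp
    · simp
      field_simp
      linear_combination - hF y
    · simp
  · have hprod := (hp (i + 2)).mul (hp i)
    have hn := hprod.near_ne_zero (mul_ne_zero hne hne')
    have hq := hB.div hprod (mul_ne_zero hne hne')
    fin_cases i
    · refine ⟨fun y => !![diagEntry l β (t y) 0, 1,
          cycleB l β γ D (t y) (s y) (w y) /
            (pairProd l β γ (t y) (s y) 2 * pairProd l β γ (t y) (s y) 0);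
        pairProd l β γ (t y) (s y) 2, diagEntry l β (t y) 1, 1;
        cycleA l β γ (t y) (s y) (w y), pairProd l β γ (t y) (s y) 0, diagEntry l β (t y) 2], ?_,
        hn.mono fun y hy => ⟨?_, ?_, ?_, ?_⟩⟩
      · intro i j
        fin_cases i <;> fin_cases j <;> first | exact h1 | exact hb _ | exact hp _ | assumption
      · intro i
        fin_cases i <;> rfl
      all_goals
        simp at hy
        obtain ⟨hy, hy'⟩ := hy
      · intro i
        fin_cases i <;> simp
        field_simp
        linear_combination hF y
      · simp
      · simp
        field_simp
    · refine ⟨fun y => !![diagEntry l β (t y) 0, cycleA l β γ (t y) (s y) (w y),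
          pairProd l β γ (t y) (s y) 1;
        cycleB l β γ D (t y) (s y) (w y) /
            (pairProd l β γ (t y) (s y) 0 * pairProd l β γ (t y) (s y) 1),
          diagEntry l β (t y) 1, 1;
        1, pairProd l β γ (t y) (s y) 0, diagEntry l β (t y) 2], ?_,
        hn.mono fun y hy => ⟨?_, ?_, ?_, ?_⟩⟩
      · intro i j
        fin_cases i <;> fin_cases j <;> first | exact h1 | exact hb _ | exact hp _ | assumption
      · intro i
        fin_cases i <;> rfl
      all_goals
        simp at hy
        obtain ⟨hy, hy'⟩ := hy
      · intro i
        fin_cases i <;> simp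
        field_simp
        linear_combination hF y
      · simp
      · simp
        field_simp
    · refine ⟨fun y => !![diagEntry l β (t y) 0, 1, pairProd l β γ (t y) (s y) 1;
        pairProd l β γ (t y) (s y) 2, diagEntry l β (t y) 1, cycleA l β γ (t y) (s y) (w y);
        1, cycleB l β γ D (t y) (s y) (w y) /
            (pairProd l β γ (t y) (s y) 1 * pairProd l β γ (t y) (s y) 2),
          diagEntry l β (t y) 2], ?_,
        hn.mono fun y hy => ⟨?_, ?_, ?_, ?_⟩⟩
      · intro i j
        fin_cases i <;> fin_cases j <;> first | exact h1 | exact hb _ | exact hp _ | assumption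
      · intro i
        fin_cases i <;> rfl
      all_goals
        simp at hy
        obtain ⟨hy, hy'⟩ := hy
      · intro i
        fin_cases i <;> simp
        field_simp
        linear_combination hF y
      · simp
      · simp
        field_simp

end Sections

/-! ### The point of the surface given by a representation -/

/-- The spectral projection of a matrix with eigenvalues `l` onto the eigenspace of `l i`. -/
def spectralProj (l : Fin 3 → ℂ) (A : Matrix (Fin 3) (Fin 3) ℂ) (i : Fin 3) :
    Matrix (Fin 3) (Fin 3) ℂ :=
  ((l i - l (i + 1)) * (l i - l (i + 2)))⁻¹ • ((A - l (i + 1) • 1) * (A - l (i + 2) • 1))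

section PointOf

variable (l β γ : Fin 3 → ℂ) (A B : Matrix (Fin 3) (Fin 3) ℂ)

/-- The coordinate `t` of a pair of matrices. -/
def coordT : ℂ := (spectralProj l A 0 * B).trace / gap l 0 - β 0

/-- The coordinate `s` of a pair of matrices. -/
def coordS : ℂ :=
  ((spectralProj l A 1 * B).trace * (spectralProj l A 2 * B).trace -
    (spectralProj l A 1 * B * (spectralProj l A 2 * B)).trace) / (l 0 * gap l 0) - γ 0

/-- The coordinate `w` of a pair of matrices. -/
def coordW : ℂ :=
  (spectralProj l A 0 * B * (spectralProj l A 1 * B) * (spectralProj l A 2 * B)).trace +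
    ∑ i, l (i + 1) * l i * gap l i * (β i + coordT l β A B) * (γ i + coordS l γ A B) -
    ∏ i, diagEntry l β (coordT l β A B) i

/-- The homogeneous coordinates of a pair of matrices. -/
def pointOf : Fin 4 → ℂ := ![1, coordT l β A B, coordS l γ A B, coordW l β γ A B]

variable {l β γ A B}

theorem spectralProj_diagonal (hl : Function.Injective l) (i : Fin 3) :
    spectralProj l (Matrix.diagonal l) i = Matrix.single i i 1 := by
  have h01 : l 0 - l 1 ≠ 0 := sub_ne_zero.2 fun h => by simpa using hl h
  have h12 : l 1 - l 2 ≠ 0 := sub_ne_zero.2 fun h => by simpa using hl h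
  have h02 : l 0 - l 2 ≠ 0 := sub_ne_zero.2 fun h => by simpa using hl h
  have h10 : l 1 - l 0 ≠ 0 := sub_ne_zero.2 fun h => by simpa using hl h
  have h21 : l 2 - l 1 ≠ 0 := sub_ne_zero.2 fun h => by simpa using hl h
  have h20 : l 2 - l 0 ≠ 0 := sub_ne_zero.2 fun h => by simpa using hl h
  ext j k
  simp only [spectralProj, Matrix.smul_apply, Matrix.mul_apply, Fin.sum_univ_three]
  fin_cases i <;> fin_cases j <;> fin_cases k <;>
    simp <;> field_simp

/-- For diagonal A the spectral projections are matrix units, so the traces become B_ii, B_12 B_21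
and B_01 B_12 B_20. The trace formulas make sense without diagonalizing A and are invariant under
conjugation. -/
theorem Realizes.pointOf {D t s w : ℂ} (hl : Function.Injective l) (hl0 : ∀ i, l i ≠ 0)
    (h : Realizes l β γ D t s w B) :
    CharVarCompactification.pointOf l β γ (Matrix.diagonal l) B = ![1, t, s, w] := by
  have g0 := gap_ne_zero hl 0
  have l0 := hl0 0
  have htr : ∀ i, (Matrix.single i i 1 * B).trace = B i i := fun i => by
    simp [Matrix.trace_single_mul]
  have hT : coordT l β (Matrix.diagonal l) B = t := by
    simp only [coordT, spectralProj_diagonal hl, htr, h.diag, diagEntry]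
    field_simp
    ring
  have hS : coordS l γ (Matrix.diagonal l) B = s := by
    have hp := h.pair 0
    have d1 := h.diag 1
    have d2 := h.diag 2
    have e : (Matrix.single 1 1 1 * B * (Matrix.single 2 2 1 * B)).trace = B 1 2 * B 2 1 := by
      simp [Matrix.trace_fin_three, Matrix.mul_apply, Fin.sum_univ_three, Matrix.single_apply]
    simp only [coordS, spectralProj_diagonal hl, e, htr]
    simp [pairProd, diagMinor] at hp
    rw [hp, d1, d2]
    field_simp
    ring
  have hW : coordW l β γ (Matrix.diagonal l) B = w := by
    have e : (Matrix.single 0 0 1 * B * (Matrix.single 1 1 1 * B) *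
        (Matrix.single 2 2 1 * B)).trace = B 0 1 * B 1 2 * B 2 0 := by
      simp [Matrix.trace_fin_three, Matrix.mul_apply, Fin.sum_univ_three, Matrix.single_apply]
    rw [coordW, hT, hS, spectralProj_diagonal hl, spectralProj_diagonal hl,
      spectralProj_diagonal hl, e, h.cycA, cycleA]
    ring
  rw [CharVarCompactification.pointOf, hT, hS, hW]

theorem spectralProj_conj (g : GL (Fin 3) ℂ) (i : Fin 3) :
    spectralProj l (g * A * (g⁻¹ : GL (Fin 3) ℂ)) i =
      g * spectralProj l A i * (g⁻¹ : GL (Fin 3) ℂ) := by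
  have hsub : ∀ a : ℂ, (g * A * (g⁻¹ : GL (Fin 3) ℂ) - a • 1 : Matrix (Fin 3) (Fin 3) ℂ) =
      g * (A - a • 1) * (g⁻¹ : GL (Fin 3) ℂ) := by
    intro a
    simp only [mul_sub, sub_mul, mul_smul_comm, smul_mul_assoc, mul_one, Units.mul_inv]
  rw [spectralProj, spectralProj, hsub, hsub, mul_smul_comm, smul_mul_assoc]
  congr 1
  simp only [mul_assoc, Units.inv_mul_cancel_left]

theorem pointOf_conj (g : GL (Fin 3) ℂ) :
    pointOf l β γ (g * A * (g⁻¹ : GL (Fin 3) ℂ)) (g * B * (g⁻¹ : GL (Fin 3) ℂ)) =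
      pointOf l β γ A B := by
  have hm : ∀ i, spectralProj l (g * A * (g⁻¹ : GL (Fin 3) ℂ)) i *
      (g * B * (g⁻¹ : GL (Fin 3) ℂ)) =
      g * (spectralProj l A i * B) * (g⁻¹ : GL (Fin 3) ℂ) := by
    intro i
    rw [spectralProj_conj]
    simp only [mul_assoc, Units.inv_mul_cancel_left]
  have hmul : ∀ M N : Matrix (Fin 3) (Fin 3) ℂ,
      (g * M * (g⁻¹ : GL (Fin 3) ℂ)) * (g * N * (g⁻¹ : GL (Fin 3) ℂ)) =
      g * (M * N) * (g⁻¹ : GL (Fin 3) ℂ) := by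
    intro M N
    simp only [mul_assoc, Units.inv_mul_cancel_left]
  have htr : ∀ M : Matrix (Fin 3) (Fin 3) ℂ,
      (g * M * (g⁻¹ : GL (Fin 3) ℂ) : Matrix (Fin 3) (Fin 3) ℂ).trace = M.trace := by
    intro M
    rw [Matrix.trace_mul_comm, ← mul_assoc, Units.inv_mul, one_mul]
  simp only [pointOf, coordT, coordS, coordW, hm, hmul, htr]

end PointOf

/-! ### Regularity of the coordinates in the matrix entries -/

section Regularity

variable {l β γ : Fin 3 → ℂ} {σ Y : Type*} {c : Y → σ → ℂ} {y₀ : Y}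
  {A B : Y → Matrix (Fin 3) (Fin 3) ℂ}

theorem regAt_trace {M : Y → Matrix (Fin 3) (Fin 3) ℂ}
    (hM : ∀ i j, RegAt c y₀ fun y => M y i j) : RegAt c y₀ fun y => (M y).trace :=
  RegAt.sum _ fun i => hM i i

theorem regAt_spectralProj (hA : ∀ i j, RegAt c y₀ fun y => A y i j) (k i j : Fin 3) :
    RegAt c y₀ fun y => spectralProj l (A y) k i j :=
  (RegAt.const _).mul (RegAt.matrix_mul
    (M := fun y => A y - l (k + 1) • 1) (N := fun y => A y - l (k + 2) • 1)
    (fun i j => (hA i j).sub (RegAt.const _)) (fun i j => (hA i j).sub (RegAt.const _)) i j)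

theorem regAt_pointOf (hA : ∀ i j, RegAt c y₀ fun y => A y i j)
    (hB : ∀ i j, RegAt c y₀ fun y => B y i j) (k : Fin 4) :
    RegAt c y₀ fun y => pointOf l β γ (A y) (B y) k := by
  have hE : ∀ m i j, RegAt c y₀ fun y => (spectralProj l (A y) m * B y) i j := fun m =>
    RegAt.matrix_mul (regAt_spectralProj hA m) hB
  have hT : RegAt c y₀ fun y => coordT l β (A y) (B y) := by
    simp only [coordT, div_eq_mul_inv]
    exact ((regAt_trace (hE 0)).mul (RegAt.const _)).sub (RegAt.const _)
  have hS : RegAt c y₀ fun y => coordS l γ (A y) (B y) := by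
    simp only [coordS, div_eq_mul_inv]
    exact ((((regAt_trace (hE 1)).mul (regAt_trace (hE 2))).sub
      (regAt_trace (RegAt.matrix_mul (hE 1) (hE 2)))).mul (RegAt.const _)).sub (RegAt.const _)
  have hW : RegAt c y₀ fun y => coordW l β γ (A y) (B y) :=
    ((regAt_trace (RegAt.matrix_mul (RegAt.matrix_mul (hE 0) (hE 1)) (hE 2))).add
      (regAt_sum_aux hT hS _)).sub (regAt_prod_diagEntry hT)
  fin_cases k
  exacts [RegAt.const 1, hT, hS, hW]

end Regularity

/-! ### The isomorphism -/

section Iso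

variable {l mu nu β γ : Fin 3 → ℂ}

/-- The matrix of the loop `a`. -/
abbrev IrrRep.matA (ρ : IrrRep l mu nu) : Matrix (Fin 3) (Fin 3) ℂ := ρ.1 (FreeGroup.of 0)

/-- The matrix of the loop `b`. -/
abbrev IrrRep.matB (ρ : IrrRep l mu nu) : Matrix (Fin 3) (Fin 3) ℂ := ρ.1 (FreeGroup.of 1)

theorem IrrRep.ext_of_mat {ρ ρ' : IrrRep l mu nu} (g : GL (Fin 3) ℂ)
    (hA : ρ'.matA * g = g * ρ.matA) (hB : ρ'.matB * g = g * ρ.matB) :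
    CharVar.mk ρ = CharVar.mk ρ' := by
  refine Quotient.sound ⟨g, ?_⟩
  have key : ρ'.1 = (MulAut.conj g).toMonoidHom.comp ρ.1 := by
    refine FreeGroup.ext_hom _ _ fun i => ?_
    simp only [MonoidHom.comp_apply, MulEquiv.coe_toMonoidHom, MulAut.conj_apply]
    rw [eq_mul_inv_iff_mul_eq]
    refine Units.ext ?_
    fin_cases i
    · exact hA
    · exact hB
  intro x
  rw [key]
  rfl

theorem charpoly_conj (g M : GL (Fin 3) ℂ) :
    ((g * M * g⁻¹ : GL (Fin 3) ℂ) : Matrix (Fin 3) (Fin 3) ℂ).charpoly =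
      (M : Matrix (Fin 3) (Fin 3) ℂ).charpoly := by
  rw [Units.val_mul, Matrix.charpoly_mul_comm, ← Units.val_mul]
  simp

/-- Every representation is conjugate to one with diagonal `ρ(a)`. -/
theorem exists_mk_eq_diagonal (hl : Function.Injective l) (ρ : IrrRep l mu nu) :
    ∃ ρ' : IrrRep l mu nu, CharVar.mk ρ' = CharVar.mk ρ ∧ ρ'.matA = Matrix.diagonal l := by
  obtain ⟨Q, hQ⟩ := exists_mul_eq_mul_diagonal hl ρ.2.2.1
  let ρ' : IrrRep l mu nu := ⟨(MulAut.conj Q⁻¹).toMonoidHom.comp ρ.1,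
    isIrreducible_conj Q⁻¹ (fun x => rfl) ρ.2.1, by
      refine ⟨?_, ?_, ?_⟩
      · exact (charpoly_conj _ _).trans ρ.2.2.1
      · exact (charpoly_conj _ _).trans ρ.2.2.2.1
      · exact (charpoly_conj _ _).trans ρ.2.2.2.2⟩
  refine ⟨ρ', (Quotient.sound ⟨Q⁻¹, fun x => rfl⟩ : CharVar.mk ρ = CharVar.mk ρ').symm, ?_⟩
  have : ρ'.matA = ((Q⁻¹ : GL (Fin 3) ℂ) : Matrix (Fin 3) (Fin 3) ℂ) *
      (ρ.matA * (Q : Matrix (Fin 3) (Fin 3) ℂ)) := by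
    simp [ρ', IrrRep.matA, mul_assoc]
  rw [this, hQ, ← mul_assoc, Units.inv_mul, one_mul]

theorem exists_irrRep (hl : Function.Injective l) (hl0 : ∀ i, l i ≠ 0) (hmu0 : ∀ i, mu i ≠ 0)
    (hdet : (∏ i, l i) * ∏ i, mu i = ∏ i, nu i) (ha : Adapted l mu nu β γ)
    {t s w : ℂ} {B : Matrix (Fin 3) (Fin 3) ℂ} (h : Realizes l β γ (∏ i, mu i) t s w B)
    (hc : Connected l β γ (∏ i, mu i) t s w) :
    ∃ ρ : IrrRep l mu nu, ρ.matA = Matrix.diagonal l ∧ ρ.matB = B := by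
  have hdA : IsUnit (Matrix.diagonal l) := by
    rw [Matrix.isUnit_iff_isUnit_det, Matrix.det_diagonal, isUnit_iff_ne_zero]
    exact Finset.prod_ne_zero_iff.2 fun i _ => hl0 i
  have hdB : IsUnit B := by
    rw [Matrix.isUnit_iff_isUnit_det, ((charpoly_eq_prod_iff _ _).1 (h.charpoly ha)).2.2,
      isUnit_iff_ne_zero]
    exact Finset.prod_ne_zero_iff.2 fun i _ => hmu0 i
  let ρ : Pi1 →* GL (Fin 3) ℂ := FreeGroup.lift ![hdA.unit, hdB.unit]
  have h0 : (ρ (FreeGroup.of 0) : Matrix (Fin 3) (Fin 3) ℂ) = Matrix.diagonal l := by simp [ρ]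
  have h1 : (ρ (FreeGroup.of 1) : Matrix (Fin 3) (Fin 3) ℂ) = B := by simp [ρ]
  refine ⟨⟨ρ, ?_, ?_, ?_, ?_⟩, h0, h1⟩
  · rw [isIrreducible_iff_stronglyConnected hl h0, h1]
    exact h.stronglyConnected_iff.2 hc
  · rw [HasEigenvalues, h0, Matrix.charpoly_diagonal]
  · rw [HasEigenvalues, h1]
    exact h.charpoly ha
  · rw [HasEigenvalues, map_mul, Units.val_mul, h0, h1]
    exact h.charpoly_mul ha hdet

theorem IrrRep.exists_realizes (hl : Function.Injective l) (hl0 : ∀ i, l i ≠ 0)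
    (ha : Adapted l mu nu β γ) {ρ : IrrRep l mu nu} (hρ : ρ.matA = Matrix.diagonal l) :
    ∃ t s w, Realizes l β γ (∏ i, mu i) t s w ρ.matB ∧
      Connected l β γ (∏ i, mu i) t s w := by
  obtain ⟨t, s, w, h⟩ := CharVarCompactification.exists_realizes hl hl0 ha ρ.2.2.2.1 (by
    have := ρ.2.2.2.2
    rw [HasEigenvalues, map_mul, Units.val_mul] at this
    rwa [← hρ])
  exact ⟨t, s, w, h, h.stronglyConnected_iff.1
    ((isIrreducible_iff_stronglyConnected hl hρ).1 ρ.2.1)⟩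

/-- Equal points mean equal cyclic products, so `exists_diagonal_conj` supplies a diagonal
conjugator, which commutes with diag l. -/
theorem Realizes.mk_eq {ρ ρ' : IrrRep l mu nu} {D t s w : ℂ} (hρ : ρ.matA = Matrix.diagonal l)
    (hρ' : ρ'.matA = Matrix.diagonal l) (h : Realizes l β γ D t s w ρ.matB)
    (h' : Realizes l β γ D t s w ρ'.matB) (hc : Connected l β γ D t s w) :
    CharVar.mk ρ = CharVar.mk ρ' := by
  have hd : ∀ i, ρ.matB i i = ρ'.matB i i := fun i => by rw [h.diag, h'.diag]
  have hp : ∀ i j, ρ.matB i j * ρ.matB j i = ρ'.matB i j * ρ'.matB j i := by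
    intro i j
    have hij : i = j ∨ (∃ k : Fin 3, i = k + 1 ∧ j = k + 2) ∨
        (∃ k : Fin 3, j = k + 1 ∧ i = k + 2) := by
      clear * -; revert i j; decide
    rcases hij with rfl | ⟨k, rfl, rfl⟩ | ⟨k, rfl, rfl⟩
    · rw [hd]
    · rw [h.pair, h'.pair]
    · rw [mul_comm, h.pair, mul_comm, h'.pair]
  have ht : ∀ i j k, ρ.matB i j * ρ.matB j k * ρ.matB k i =
      ρ'.matB i j * ρ'.matB j k * ρ'.matB k i := by
    intro i j k
    have hA := h.cycA.trans h'.cycA.symm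
    have hB := h.cycB.trans h'.cycB.symm
    -- Coinciding indices reduce to diagonal entries and 2-cycles; distinct ones give a rotation of
    -- one of the two 3-cycles.
    by_cases hij : i = j
    · subst hij
      linear_combination ρ.matB i i * hp i k + ρ'.matB i k * ρ'.matB k i * hd i
    by_cases hjk : j = k
    · subst hjk
      linear_combination ρ.matB j j * hp i j + ρ'.matB i j * ρ'.matB j i * hd j
    by_cases hik : i = k
    · subst hik
      linear_combination ρ.matB i i * hp i j + ρ'.matB i j * ρ'.matB j i * hd i
    have hcases : (i = 0 ∧ j = 1 ∧ k = 2) ∨ (i = 1 ∧ j = 2 ∧ k = 0) ∨ (i = 2 ∧ j = 0 ∧ k = 1) ∨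
        (i = 0 ∧ j = 2 ∧ k = 1) ∨ (i = 2 ∧ j = 1 ∧ k = 0) ∨ (i = 1 ∧ j = 0 ∧ k = 2) := by
      clear * - hij hjk hik
      revert i j k; decide
    rcases hcases with ⟨rfl, rfl, rfl⟩ | ⟨rfl, rfl, rfl⟩ | ⟨rfl, rfl, rfl⟩ | ⟨rfl, rfl, rfl⟩ |
      ⟨rfl, rfl, rfl⟩ | ⟨rfl, rfl, rfl⟩
    · exact hA
    · linear_combination hA
    · linear_combination hA
    · exact hB
    · linear_combination hB
    · linear_combination hB
  obtain ⟨g, hg0, hg⟩ := exists_diagonal_conj (h.stronglyConnected_iff.2 hc) hd hp ht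
  have hu : IsUnit (Matrix.diagonal g) := by
    rw [Matrix.isUnit_iff_isUnit_det, Matrix.det_diagonal, isUnit_iff_ne_zero]
    exact Finset.prod_ne_zero_iff.2 fun i _ => hg0 i
  refine IrrRep.ext_of_mat hu.unit ?_ ?_
  · rw [IsUnit.unit_spec, hρ, hρ', Matrix.diagonal_mul_diagonal, Matrix.diagonal_mul_diagonal]
    simp only [mul_comm]
  · ext i j
    rw [IsUnit.unit_spec, Matrix.mul_diagonal, Matrix.diagonal_mul, hg]

theorem pointOf_ne_zero (A B : Matrix (Fin 3) (Fin 3) ℂ) : pointOf l β γ A B ≠ 0 :=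
  affine_ne_zero _ _ _

theorem pointOf_congr {ρ ρ' : IrrRep l mu nu} (h : CharVar.mk ρ = CharVar.mk ρ') :
    pointOf l β γ ρ.matA ρ.matB = pointOf l β γ ρ'.matA ρ'.matB := by
  obtain ⟨g, hg⟩ := Quotient.exact h
  have hA : ρ'.matA = g * ρ.matA * (g⁻¹ : GL (Fin 3) ℂ) := congrArg Units.val (hg _)
  have hB : ρ'.matB = g * ρ.matB * (g⁻¹ : GL (Fin 3) ℂ) := congrArg Units.val (hg _)
  rw [hA, hB, pointOf_conj]

/-- The map is `pointOf`, regular and constant on conjugacy classes. The local normal forms give its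
surjectivity and the local lifts of its inverse. -/
theorem charVarIso_smoothAffine (hl : Function.Injective l)
    (hmu : Function.Injective mu) (hnu : Function.Injective nu)
    (hl0 : ∀ i, l i ≠ 0) (hmu0 : ∀ i, mu i ≠ 0) (hdet : (∏ i, l i) * ∏ i, mu i = ∏ i, nu i)
    (ha : Adapted l mu nu β γ) :
    CharVarIso l mu nu (smoothAffine (cubic l β γ (∏ i, mu i))) := by
  set F := cubic l β γ (∏ i, mu i) with hF
  have hmem := fun {v : Fin 4 → ℂ} (hv : v ≠ 0) =>
    mk_mem_smoothAffine_iff hl hmu hnu hl0 hmu0 hdet ha hv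
  have hrep : ∀ ρ : IrrRep l mu nu, ∃ ρ' : IrrRep l mu nu, ∃ t s w, CharVar.mk ρ' = CharVar.mk ρ ∧
      ρ'.matA = Matrix.diagonal l ∧ Realizes l β γ (∏ i, mu i) t s w ρ'.matB ∧
      Connected l β γ (∏ i, mu i) t s w ∧
      pointOf l β γ ρ.matA ρ.matB = ![1, t, s, w] := by
    intro ρ
    obtain ⟨ρ', h1, h2⟩ := exists_mk_eq_diagonal hl ρ
    obtain ⟨t, s, w, h3, h4⟩ := IrrRep.exists_realizes hl hl0 ha h2
    exact ⟨ρ', t, s, w, h1, h2, h3, h4, by rw [← pointOf_congr h1, h2, h3.pointOf hl hl0]⟩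
  have hpt : ∀ ρ : IrrRep l mu nu,
      Projectivization.mk ℂ (pointOf l β γ ρ.matA ρ.matB) (pointOf_ne_zero _ _) ∈
        smoothAffine F := by
    intro ρ
    obtain ⟨ρ', t, s, w, h1, h2, h3, h4, h5⟩ := hrep ρ
    rw [hmem, h5]
    simp only [Matrix.cons_val, div_one]
    exact ⟨one_ne_zero, eval_cubic_eq_zero_iff.2 h3.cycleA_mul_cycleB, h4⟩
  let f : CharVar l mu nu → smoothAffine F := Quotient.lift (fun ρ => ⟨_, hpt ρ⟩) (by
    intro ρ ρ' h
    have := pointOf_congr (β := β) (γ := γ) (Quotient.sound h : CharVar.mk ρ = CharVar.mk ρ')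
    simp only [this])
  have hf : ∀ ρ : IrrRep l mu nu, (f (CharVar.mk ρ) : ℙ ℂ (Fin 4 → ℂ)) =
      Projectivization.mk ℂ (pointOf l β γ ρ.matA ρ.matB) (pointOf_ne_zero _ _) := fun _ => rfl
  have hfinj : Function.Injective f := by
    intro x x' hx
    obtain ⟨ρ, rfl⟩ := Quotient.exists_rep x
    obtain ⟨ρ', rfl⟩ := Quotient.exists_rep x'
    change f (CharVar.mk ρ) = f (CharVar.mk ρ') at hx
    change CharVar.mk ρ = CharVar.mk ρ'
    obtain ⟨ρ₁, t, s, w, h1, h2, h3, h4, h5⟩ := hrep ρ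
    obtain ⟨ρ₁', t', s', w', h1', h2', h3', h4', h5'⟩ := hrep ρ'
    have hx' := congrArg Subtype.val hx
    rw [hf, hf] at hx'
    simp only [h5, h5'] at hx'
    obtain ⟨rfl, rfl, rfl⟩ := mk_affine_inj hx'
    rw [← h1, ← h1']
    exact h3.mk_eq h2 h2' h3' h4
  have hcone : ∀ y : Cone (smoothAffine F), y.1 0 ≠ 0 ∧
      eval ![1, y.1 1 / y.1 0, y.1 2 / y.1 0, y.1 3 / y.1 0] F = 0 ∧
      Connected l β γ (∏ i, mu i) (y.1 1 / y.1 0) (y.1 2 / y.1 0) (y.1 3 / y.1 0) :=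
    fun y => (hmem y.2.choose).1 y.2.choose_spec
  have hlift : ∀ (y : Cone (smoothAffine F)) (B : Matrix (Fin 3) (Fin 3) ℂ),
      Realizes l β γ (∏ i, mu i) (y.1 1 / y.1 0) (y.1 2 / y.1 0) (y.1 3 / y.1 0) B →
      ∃ ρ : IrrRep l mu nu, ρ.matA = Matrix.diagonal l ∧ ρ.matB = B ∧
        f (CharVar.mk ρ) = Cone.proj y := by
    intro y B hB
    obtain ⟨hy0, -, hyc⟩ := hcone y
    obtain ⟨ρ, h1, h2⟩ := exists_irrRep hl hl0 hmu0 hdet ha hB hyc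
    refine ⟨ρ, h1, h2, Subtype.ext ?_⟩
    have hp : pointOf l β γ ρ.matA ρ.matB =
        ![1, y.1 1 / y.1 0, y.1 2 / y.1 0, y.1 3 / y.1 0] := by rw [h1, h2, hB.pointOf hl hl0]
    rw [hf]
    simp only [hp]
    exact (mk_eq_mk_affine y.2.choose hy0).symm
  have hsec : ∀ y₀ : Cone (smoothAffine F), ∃ B : Cone (smoothAffine F) → Matrix (Fin 3) (Fin 3) ℂ,
      (∀ i j, RegAt Cone.coord y₀ fun y => B y i j) ∧ Near Cone.coord y₀ fun y =>
        Realizes l β γ (∏ i, mu i) (y.1 1 / y.1 0) (y.1 2 / y.1 0) (y.1 3 / y.1 0) (B y) := by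
    intro y₀
    have hr : ∀ i, RegAt Cone.coord y₀ fun y : Cone (smoothAffine F) => y.1 i / y.1 0 :=
      fun i => (RegAt.coord (c := Cone.coord) i).div (RegAt.coord (c := Cone.coord) 0) (hcone y₀).1
    exact exists_local_realization (hr 1) (hr 2) (hr 3)
      (fun y => eval_cubic_eq_zero_iff.1 (hcone y).2.1) (hcone y₀).2.2
  have hfsurj : Function.Surjective f := by
    rintro ⟨P, hP⟩
    induction P using Projectivization.ind with
    | h v hv =>
    obtain ⟨B, -, hB⟩ := hsec ⟨v, hv, hP⟩
    obtain ⟨ρ, -, -, hρ⟩ := hlift _ _ hB.self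
    exact ⟨_, hρ⟩
  refine ⟨Equiv.ofBijective f ⟨hfinj, hfsurj⟩, isIsoOfVarieties_of_locallyLifts ?_ ?_⟩
  · intro ρ₀
    have hreg : ∀ k i j, RegAt IrrRep.coord ρ₀ fun ρ : IrrRep l mu nu =>
        (ρ.1 (FreeGroup.of k) : Matrix (Fin 3) (Fin 3) ℂ) i j :=
      fun k i j => RegAt.coord (c := IrrRep.coord) (k, i, j)
    refine ⟨fun ρ => pointOf l β γ ρ.matA ρ.matB, regAt_pointOf (hreg 0) (hreg 1),
      1, by simp, fun ρ _ => ⟨⟨_, _, hpt ρ⟩, rfl, rfl⟩⟩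
  · intro y₀
    obtain ⟨B, hBreg, hB⟩ := hsec y₀
    refine ⟨fun y k => (![Matrix.diagonal l, B y] : Fin 2 → Matrix (Fin 3) (Fin 3) ℂ)
      k.1 k.2.1 k.2.2, ?_, hB.mono fun y hy => ?_⟩
    · rintro ⟨k, i, j⟩
      fin_cases k
      · exact RegAt.const _
      · exact hBreg i j
    · obtain ⟨ρ, h1, h2, h3⟩ := hlift y _ hy
      refine ⟨ρ, ?_, ?_⟩
      · ext ⟨k, i, j⟩
        fin_cases k
        · exact congrFun (congrFun h1 i) j
        · exact congrFun (congrFun h2 i) j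
      · rw [Equiv.eq_symm_apply]
        exact h3

end Iso

/-! ### Singular points of the surface -/

section SingularPoints

variable {l mu nu β γ : Fin 3 → ℂ} {D t s w : ℂ}

theorem not_connected_iff : ¬ Connected l β γ D t s w ↔
    cycleA l β γ t s w = 0 ∧ cycleB l β γ D t s w = 0 ∧
      ∃ k, pairProd l β γ t s (k + 1) = 0 ∧ pairProd l β γ t s (k + 2) = 0 := by
  simp only [Connected, not_or, not_not, not_exists, not_and_or]
  refine and_congr_right fun _ => and_congr_right fun _ => ?_
  simp only [Fin.forall_fin_succ, Fin.exists_fin_succ, Fin.exists_fin_zero]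
  simp
  tauto

/-- The point is realized by a matrix whose `k`-th row vanishes off the diagonal, so its diagonal
entry there is an eigenvalue, and likewise for the product with diag l. -/
theorem exists_eigenvalues_of_not_connected (ha : Adapted l mu nu β γ)
    (hdet : (∏ i, l i) * ∏ i, mu i = ∏ i, nu i) {k : Fin 3}
    (hA : cycleA l β γ t s w = 0) (hB : cycleB l β γ (∏ i, mu i) t s w = 0)
    (h1 : pairProd l β γ t s (k + 1) = 0) (h2 : pairProd l β γ t s (k + 2) = 0) :
    (∃ m, diagEntry l β t k = mu m) ∧ ∃ n, l k * diagEntry l β t k = nu n := by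
  let B : Matrix (Fin 3) (Fin 3) ℂ := Matrix.of fun i j =>
    if i = j then diagEntry l β t i else if i = k + 1 ∧ j = k + 2 then 1 else
      if i = k + 2 ∧ j = k + 1 then pairProd l β γ t s k else 0
  have hR : Realizes l β γ (∏ i, mu i) t s w B := by
    refine ⟨fun i => by simp [B], fun i => ?_, ?_, ?_⟩
    · fin_cases k <;> fin_cases i <;> simp at h1 h2 <;> simp [B, h1, h2]
    · rw [hA]
      fin_cases k <;> simp [B]
    · rw [hB]
      fin_cases k <;> simp [B]
  have hrow : ∀ j, j ≠ k → B k j = 0 := by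
    intro j hj
    have e1 : k ≠ k + 1 := by clear * -; revert k; decide
    have e2 : k ≠ k + 2 := by clear * -; revert k; decide
    simp [B, hj.symm, e1, e2]
  have hkk : B k k = diagEntry l β t k := hR.diag k
  constructor
  · have h := congrArg (Polynomial.eval (diagEntry l β t k)) (hR.charpoly ha)
    rw [Matrix.eval_charpoly, Matrix.det_eq_zero_of_row_eq_zero k, Polynomial.eval_prod] at h
    · obtain ⟨m, -, hm⟩ := Finset.prod_eq_zero_iff.1 h.symm
      exact ⟨m, by simpa [sub_eq_zero] using hm⟩
    · intro j
      by_cases hj : j = k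
      · simp [hj, hkk]
      · simp [hrow j hj, Ne.symm hj]
  · have h := congrArg (Polynomial.eval (l k * diagEntry l β t k)) (hR.charpoly_mul ha hdet)
    rw [Matrix.eval_charpoly, Matrix.det_eq_zero_of_row_eq_zero k, Polynomial.eval_prod] at h
    · obtain ⟨m, -, hm⟩ := Finset.prod_eq_zero_iff.1 h.symm
      exact ⟨m, by simpa [sub_eq_zero] using hm⟩
    · intro j
      by_cases hj : j = k
      · simp [hj, hkk]
      · simp [hrow j hj, Ne.symm hj]

/-- The derivatives along the plane at infinity vanish together only at the node t = s = 0 of the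
boundary, where the derivative in x₀ is -w² ≠ 0. -/
theorem disjoint_singularLocus_boundary (hl : Function.Injective l) (hl0 : ∀ i, l i ≠ 0)
    (hD : D ≠ 0) :
    Disjoint (singularLocus (cubic l β γ D)) (boundary (cubic l β γ D)) := by
  rw [Set.disjoint_left]
  intro P
  induction P using Projectivization.ind with
  | h v hv =>
  have hF := cubic_isHomogeneous l β γ D
  rw [mk_mem_singularLocus_iff hF, mk_mem_boundary_iff hF]
  rintro ⟨-, h⟩ ⟨-, h0⟩
  obtain ⟨t, s, w, rfl⟩ : ∃ t s w, v = ![0, t, s, w] :=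
    ⟨v 1, v 2, v 3, by ext i; fin_cases i <;> simp [h0]⟩
  have hg : (l 1 - l 2) * (l 2 - l 0) * (l 0 - l 1) ≠ 0 :=
    mul_ne_zero (mul_ne_zero (gap_ne_zero hl 0) (gap_ne_zero hl 1)) (gap_ne_zero hl 2)
  have e0 := h 0
  have e1 := h 1
  have e2 := h 2
  simp [cubic, pderiv_X, Fin.sum_univ_three, Fin.prod_univ_three, gap] at e0 e1 e2
  have f1 : w * s + 3 * D * t ^ 2 = 0 := (mul_eq_zero.1 (by linear_combination e1 :
    (l 1 - l 2) * (l 2 - l 0) * (l 0 - l 1) * (w * s + 3 * D * t ^ 2) = 0)).resolve_left hg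
  have f2 : w * t + 3 * (l 0 * l 1 * l 2) * s ^ 2 = 0 :=
    (mul_eq_zero.1 (by linear_combination e2 : (l 1 - l 2) * (l 2 - l 0) * (l 0 - l 1) *
      (w * t + 3 * (l 0 * l 1 * l 2) * s ^ 2) = 0)).resolve_left hg
  have e3 := h 3
  simp [cubic, pderiv_X, Fin.sum_univ_three, Fin.prod_univ_three, gap] at e3
  have f3 : t * s = 0 := (mul_eq_zero.1 (by linear_combination e3 :
    (l 1 - l 2) * (l 2 - l 0) * (l 0 - l 1) * (t * s) = 0)).resolve_left hg
  have hts : t = 0 ∧ s = 0 := by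
    rcases mul_eq_zero.1 f3 with rfl | rfl
    · simpa [hl0] using f2
    · simpa [hD] using f1
  obtain ⟨rfl, rfl⟩ := hts
  have hw : w = 0 := by simpa using e0
  apply hv
  ext i
  fin_cases i <;> simp [hw]

theorem exists_affine_of_mem_singularLocus (hl : Function.Injective l) (hl0 : ∀ i, l i ≠ 0)
    (hD : D ≠ 0) {P : ℙ ℂ (Fin 4 → ℂ)} (hP : P ∈ singularLocus (cubic l β γ D)) :
    ∃ t s w, P = Projectivization.mk ℂ ![1, t, s, w] (affine_ne_zero t s w) := by
  have hb := Set.disjoint_left.1 (disjoint_singularLocus_boundary hl hl0 hD) hP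
  induction P using Projectivization.ind with
  | h v hv =>
  have hF := cubic_isHomogeneous l β γ D
  rw [mk_mem_boundary_iff hF] at hb
  rw [mk_mem_singularLocus_iff hF] at hP
  exact ⟨_, _, _, mk_eq_mk_affine hv fun h0 => hb ⟨hP.1, h0⟩⟩

theorem singularLocus_finite (hl : Function.Injective l)
    (hmu : Function.Injective mu) (hnu : Function.Injective nu)
    (hl0 : ∀ i, l i ≠ 0) (hmu0 : ∀ i, mu i ≠ 0) (hdet : (∏ i, l i) * ∏ i, mu i = ∏ i, nu i)
    (ha : Adapted l mu nu β γ) : (singularLocus (cubic l β γ (∏ i, mu i))).Finite := by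
  -- Nine candidates: `t` is solved from d_k = mu_m, then `s` from p_{k+1} = 0, then `w` from
  -- `cycleA` = 0.
  let T : Fin 3 × Fin 3 → ℂ := fun k => mu k.2 / gap l k.1 - β k.1
  let S : Fin 3 × Fin 3 → ℂ := fun k =>
    diagEntry l β (T k) (k.1 + 1 + 1) * diagEntry l β (T k) (k.1 + 1 + 2) /
      (l (k.1 + 1) * gap l (k.1 + 1)) - γ (k.1 + 1)
  let W : Fin 3 × Fin 3 → ℂ := fun k =>
    ∑ i, l (i + 1) * l i * gap l i * (β i + T k) * (γ i + S k) - ∏ i, diagEntry l β (T k) i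
  refine (Set.finite_range fun k => Projectivization.mk ℂ ![1, T k, S k, W k]
    (affine_ne_zero _ _ _)).subset ?_
  intro P hP
  obtain ⟨t, s, w, rfl⟩ := exists_affine_of_mem_singularLocus hl hl0
    (Finset.prod_ne_zero_iff.2 fun i _ => hmu0 i) hP
  rw [mk_affine_mem_singularLocus_iff hl hmu hnu hl0 hmu0 hdet ha, not_connected_iff] at hP
  obtain ⟨-, hA, hB, k, h1, h2⟩ := hP
  obtain ⟨⟨m, hm⟩, -⟩ := exists_eigenvalues_of_not_connected ha hdet hA hB h1 h2
  have hT : T (k, m) = t := by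
    simp only [T]
    rw [← hm, diagEntry, mul_div_cancel_left₀ _ (gap_ne_zero hl k)]
    ring
  have hS : S (k, m) = s := by
    simp only [S, hT]
    rw [pairProd, sub_eq_zero, diagMinor] at h1
    rw [h1, mul_div_cancel_left₀ _ (mul_ne_zero (hl0 _) (gap_ne_zero hl _))]
    ring
  have hW : W (k, m) = w := by
    simp only [W, hT, hS]
    rw [cycleA] at hA
    linear_combination -hA
  exact ⟨(k, m), by simp only [hT, hS, hW]⟩

theorem singularLocus_eq_empty (hl : Function.Injective l)
    (hmu : Function.Injective mu) (hnu : Function.Injective nu)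
    (hl0 : ∀ i, l i ≠ 0) (hmu0 : ∀ i, mu i ≠ 0) (hdet : (∏ i, l i) * ∏ i, mu i = ∏ i, nu i)
    (ha : Adapted l mu nu β γ) (hgen : ∀ i j k, l i * mu j ≠ nu k) :
    singularLocus (cubic l β γ (∏ i, mu i)) = ∅ := by
  rw [Set.eq_empty_iff_forall_notMem]
  intro P hP
  obtain ⟨t, s, w, rfl⟩ := exists_affine_of_mem_singularLocus hl hl0
    (Finset.prod_ne_zero_iff.2 fun i _ => hmu0 i) hP
  rw [mk_affine_mem_singularLocus_iff hl hmu hnu hl0 hmu0 hdet ha, not_connected_iff] at hP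
  obtain ⟨-, hA, hB, k, h1, h2⟩ := hP
  obtain ⟨⟨m, hm⟩, ⟨n, hn⟩⟩ := exists_eigenvalues_of_not_connected ha hdet hA hB h1 h2
  exact hgen k m n (by rw [← hm, hn])

end SingularPoints

/-! ### Nodal plane cubics -/

/-- A plane cubic with a node at `(0 : 0 : 1)` and the tangent lines `x = 0`, `y = 0` there. -/
def nodalCubic (a b e : ℂ) : MvPolynomial (Fin 3) ℂ :=
  C a * (X 0 * X 1 * X 2 + C b * X 0 ^ 3 + C e * X 1 ^ 3)

/-- The mixed coefficient is ∑ (l_{i+1} + l_{i+2}) l_i gap_i = ∏ gap_i; the two pure cubes come from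
the last two products in `cubic`. -/
theorem boundaryEquation_cubic (l β γ : Fin 3 → ℂ) (D : ℂ) :
    boundaryEquation (cubic l β γ D) = nodalCubic (∏ i, gap l i) D (∏ i, l i) := by
  have h1 : (Fin.cons 0 X : Fin 4 → MvPolynomial (Fin 3) ℂ) 1 = X 0 := rfl
  have h2 : (Fin.cons 0 X : Fin 4 → MvPolynomial (Fin 3) ℂ) 2 = X 1 := rfl
  have h3 : (Fin.cons 0 X : Fin 4 → MvPolynomial (Fin 3) ℂ) 3 = X 2 := rfl
  simp [boundaryEquation, cubic, nodalCubic, Fin.sum_univ_three, Fin.prod_univ_three, gap,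
    h1, h2, h3, algebraMap_eq]
  ring

section NodalCubic

variable {a b e : ℂ}

theorem nodalCubic_isHomogeneous (a b e : ℂ) : (nodalCubic a b e).IsHomogeneous 3 :=
  (((((isHomogeneous_X ℂ 0).mul (isHomogeneous_X ℂ 1)).mul (isHomogeneous_X ℂ 2)).add
    (isHomogeneous_C_mul_X_pow b 0 3)).add (isHomogeneous_C_mul_X_pow e 1 3)).C_mul a

theorem eval_nodalCubic (v : Fin 3 → ℂ) :
    eval v (nodalCubic a b e) = a * (v 0 * v 1 * v 2 + b * v 0 ^ 3 + e * v 1 ^ 3) := by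
  simp [nodalCubic]

/-- Up to a unit it is linear in `X 2`, with coprime coefficients. -/
theorem irreducible_nodalCubic (ha : a ≠ 0) (hb : b ≠ 0) (he : e ≠ 0) :
    Irreducible (nodalCubic a b e) := by
  have hu : IsUnit (C a : MvPolynomial (Fin 3) ℂ) := (isUnit_iff_ne_zero.2 ha).map C
  have hX : ∀ i, Irreducible (X i : MvPolynomial (Fin 3) ℂ) := fun i => X_prime.irreducible
  have hrel : IsRelPrime (X 0 * X 1 : MvPolynomial (Fin 3) ℂ) (C b * X 0 ^ 3 + C e * X 1 ^ 3) := by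
    refine IsRelPrime.mul_left ?_ ?_
    · rw [(hX 0).isRelPrime_iff_not_dvd]
      rintro ⟨q, hq⟩
      have := congrArg (eval ![0, 1, 0]) hq
      simp [he] at this
    · rw [(hX 1).isRelPrime_iff_not_dvd]
      rintro ⟨q, hq⟩
      have := congrArg (eval ![1, 0, 0]) hq
      simp [hb] at this
  have hirr : Irreducible ((X 0 * X 1 : MvPolynomial (Fin 3) ℂ) * X 2 +
      (C b * X 0 ^ 3 + C e * X 1 ^ 3)) := by
    refine irreducible_mul_X_add _ _ 2 (mul_ne_zero (hX 0).ne_zero (hX 1).ne_zero) ?_ ?_ hrel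
    · intro h
      have := vars_mul _ _ h
      simp [vars_X] at this
    · intro h
      rcases Finset.mem_union.1 (vars_add_subset _ _ h) with h | h
      · have := Finset.mem_union.1 (vars_mul _ _ h)
        rcases this with h | h
        · simp at h
        · have := vars_pow _ _ h
          simp [vars_X] at this
      · have := Finset.mem_union.1 (vars_mul _ _ h)
        rcases this with h | h
        · simp at h
        · have := vars_pow _ _ h
          simp [vars_X] at this
  rw [nodalCubic, irreducible_isUnit_mul hu, add_assoc]
  exact hirr

/-- Projection from the node: a line through the double point has one remaining intersection with
the cubic. -/
theorem isParametrizedByLine_nodalCubic (ha : a ≠ 0) (hb : b ≠ 0) (he : e ≠ 0) :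
    IsParametrizedByLine (nodalCubic a b e) := by
  have hG := nodalCubic_isHomogeneous a b e
  let φ : Fin 3 → MvPolynomial (Fin 2) ℂ :=
    ![X 0 ^ 2 * X 1, X 0 * X 1 ^ 2, -(C b * X 0 ^ 3 + C e * X 1 ^ 3)]
  have hφ : ∀ s : Fin 2 → ℂ, (fun i => eval s (φ i)) =
      ![s 0 ^ 2 * s 1, s 0 * s 1 ^ 2, -(b * s 0 ^ 3 + e * s 1 ^ 3)] := by
    intro s
    ext i
    fin_cases i <;> simp [φ]
  have hne : ∀ s : Fin 2 → ℂ, s ≠ 0 → (fun i => eval s (φ i)) ≠ 0 := by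
    intro s hs h
    rw [hφ] at h
    have h0 := congrFun h 0
    have h2 := congrFun h 2
    simp at h0 h2
    apply hs
    ext i
    rcases h0 with h0 | h0 <;> fin_cases i <;> simp_all
  refine ⟨3, φ, by norm_num, ?_, hne, ?_⟩
  · intro i
    have hX : ∀ i, (X i : MvPolynomial (Fin 2) ℂ).IsHomogeneous 1 := isHomogeneous_X ℂ
    fin_cases i
    · exact ((hX 0).pow 2).mul (hX 1)
    · exact (hX 0).mul ((hX 1).pow 2)
    · exact ((isHomogeneous_C_mul_X_pow b 0 3).add (isHomogeneous_C_mul_X_pow e 1 3)).neg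
  · intro P
    induction P using Projectivization.ind with
    | h v hv =>
    rw [mk_mem_hypersurface_iff hG, eval_nodalCubic]
    simp only [Projectivization.mk_eq_mk_iff', exists_prop]
    constructor
    · intro h
      have h := (mul_eq_zero.1 h).resolve_left ha
      by_cases h0 : v 0 = 0
      · have h1 : v 1 = 0 := by simpa [h0, he] using h
        have h2 : v 2 ≠ 0 := fun h2 => hv (by ext i; fin_cases i <;> simp [h0, h1, h2])
        -- The parameter of one of the two branches at the node.
        refine ⟨![1, 0], hne _ (fun h => one_ne_zero (congrFun h 0)), -b / v 2, ?_⟩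
        rw [hφ]
        ext i
        fin_cases i <;> simp [h0, h1, h2]
      · have h1 : v 1 ≠ 0 := fun h1 => h0 (by simpa [h1, hb] using h)
        refine ⟨![v 0, v 1], hne _ (fun h => h0 (congrFun h 0)), v 0 * v 1, ?_⟩
        rw [hφ]
        ext i
        fin_cases i <;> simp
        · ring
        · ring
        · linear_combination h
    · rintro ⟨s, hs, c, hc⟩
      rw [hφ] at hs hc
      have hc0 : c ≠ 0 := fun h => hs (by rw [← hc, h, zero_smul])
      have h0 := congrFun hc 0
      have h1 := congrFun hc 1
      have h2 := congrFun hc 2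
      simp at h0 h1 h2
      refine (mul_eq_zero.1 (?_ : c ^ 3 * _ = 0)).resolve_left (pow_ne_zero 3 hc0)
      have : c ^ 3 * (a * (v 0 * v 1 * v 2 + b * v 0 ^ 3 + e * v 1 ^ 3)) =
        a * ((c * v 0) * (c * v 1) * (c * v 2) + b * (c * v 0) ^ 3 + e * (c * v 1) ^ 3) := by ring
      rw [this, h0, h1, h2]
      ring

theorem node_ne_zero : (![0, 0, 1] : Fin 3 → ℂ) ≠ 0 := fun h => one_ne_zero (congrFun h 2)

/-- The node of `nodalCubic`. -/
def nodePoint : ℙ ℂ (Fin 3 → ℂ) := Projectivization.mk ℂ ![0, 0, 1] node_ne_zero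

theorem exists_rep_nodePoint : ∃ c : ℂ, c ≠ 0 ∧ nodePoint.rep = ![0, 0, c] := by
  obtain ⟨c, hc, h⟩ := exists_rep_eq_smul node_ne_zero
  exact ⟨c, hc, h.trans (by simp)⟩

theorem singularLocus_nodalCubic (ha : a ≠ 0) (hb : b ≠ 0) (he : e ≠ 0) :
    singularLocus (nodalCubic a b e) = {nodePoint} := by
  ext P
  induction P using Projectivization.ind with
  | h v hv =>
  rw [mk_mem_singularLocus_iff (nodalCubic_isHomogeneous a b e), Set.mem_singleton_iff, nodePoint,
    Projectivization.mk_eq_mk_iff', eval_nodalCubic]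
  constructor
  · rintro ⟨-, h⟩
    have e0 := h 0
    have e1 := h 1
    have e2 := h 2
    simp [nodalCubic, pderiv_X, ha] at e0 e1 e2
    have h01 : v 0 = 0 ∧ v 1 = 0 := by
      rcases e2 with h0 | h1
      · simpa [h0, he] using e1
      · simpa [h1, hb] using e0
    refine ⟨v 2, ?_⟩
    ext i
    fin_cases i <;> simp [h01]
  · rintro ⟨c, rfl⟩
    refine ⟨by simp, fun i => ?_⟩
    fin_cases i <;> simp [nodalCubic, pderiv_X]

theorem hessian_nodalCubic (c : ℂ) :
    hessian (nodalCubic a b e) ![0, 0, c] = !![0, a * c, 0; a * c, 0, 0; 0, 0, 0] := by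
  ext i j
  fin_cases i <;> fin_cases j <;> simp [hessian, nodalCubic, pderiv_X]

theorem isNode_nodePoint (ha : a ≠ 0) (hb : b ≠ 0) (he : e ≠ 0) :
    IsNode (nodalCubic a b e) nodePoint := by
  refine ⟨by rw [singularLocus_nodalCubic ha hb he]; rfl, ?_⟩
  obtain ⟨c, hc, h⟩ := exists_rep_nodePoint
  rw [h, hessian_nodalCubic]
  have hx : a * c ≠ 0 := mul_ne_zero ha hc
  -- Exchanging two rows makes the Hessian diagonal, where the rank can be counted.
  have key : (!![0, a * c, 0; a * c, 0, 0; 0, 0, 0] : Matrix (Fin 3) (Fin 3) ℂ) =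
      (Matrix.diagonal ![a * c, a * c, 0]).submatrix (Equiv.swap 0 1) (Equiv.refl _) := by
    ext i j
    fin_cases i <;> fin_cases j <;> simp [Equiv.swap_apply_def]
  have hfilter : ({i | ![a * c, a * c, 0] i ≠ 0} : Finset (Fin 3)) = {0, 1} := by
    ext i
    fin_cases i <;> simp [ha, hc]
  rw [key, Matrix.rank_submatrix, Matrix.rank_diagonal, Fintype.card_subtype, hfilter]
  rfl

theorem isTypeI1_nodalCubic (ha : a ≠ 0) (hb : b ≠ 0) (he : e ≠ 0) :
    IsTypeI1 (nodalCubic a b e) :=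
  ⟨nodalCubic_isHomogeneous a b e, irreducible_nodalCubic ha hb he,
    isParametrizedByLine_nodalCubic ha hb he,
    nodePoint, singularLocus_nodalCubic ha hb he, isNode_nodePoint ha hb he⟩

end NodalCubic

/-! ### Irreducibility of the surface -/

theorem totalDegree_boundaryEquation_le (F : MvPolynomial (Fin 4) ℂ) :
    (boundaryEquation F).totalDegree ≤ F.totalDegree := by
  rw [boundaryEquation, aeval_def, eval₂_eq]
  refine totalDegree_finsetSum_le fun d hd => ?_
  refine (totalDegree_mul _ _).trans ?_
  rw [algebraMap_eq, totalDegree_C, zero_add]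
  refine (totalDegree_finsetProd _ _).trans ?_
  refine le_trans (Finset.sum_le_sum fun i _ => ?_) (le_totalDegree hd)
  refine (totalDegree_pow _ _).trans (mul_le_of_le_one_right' ?_)
  refine Fin.cases ?_ (fun j => ?_) i
  · simp
  · exact (totalDegree_X _).le

/-- By homogeneity, restriction to the plane preserves the degree of `F`, and it never raises that
of a factor. If `P` restricts to a unit, its cofactor already has the full degree, so `P` is
constant. -/
theorem irreducible_of_boundaryEquation {F : MvPolynomial (Fin 4) ℂ} {d : ℕ}
    (hF : F.IsHomogeneous d) (h : Irreducible (boundaryEquation F)) : Irreducible F := by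
  have hd : (boundaryEquation F).totalDegree = F.totalDegree := by
    have hG : (boundaryEquation F).IsHomogeneous d := by
      have := hF.aeval (Fin.cons 0 X : Fin 4 → MvPolynomial (Fin 3) ℂ) (n := 1) (fun i => by
        refine Fin.cases ?_ (fun j => ?_) i
        · exact isHomogeneous_zero _ _ _
        · exact isHomogeneous_X _ _)
      rwa [one_mul] at this
    rw [hG.totalDegree h.ne_zero, hF.totalDegree]
    rintro rfl
    exact h.ne_zero (map_zero _)
  have key : ∀ P Q : MvPolynomial (Fin 4) ℂ, F = P * Q → IsUnit (boundaryEquation P) → IsUnit P := by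
    intro P Q hPQ hP
    have hmul : boundaryEquation F = boundaryEquation P * boundaryEquation Q := by
      rw [hPQ]; exact map_mul _ _ _
    have hne := h.ne_zero
    rw [hmul, mul_ne_zero_iff] at hne
    have hP0 : P ≠ 0 := by
      rintro rfl
      exact hne.1 (map_zero _)
    have hQ0 : Q ≠ 0 := by
      rintro rfl
      exact hne.2 (map_zero _)
    have h1 := totalDegree_mul_of_isDomain hne.1 hne.2
    have h2 := totalDegree_mul_of_isDomain hP0 hQ0
    have h3 := totalDegree_boundaryEquation_le Q
    have h4 : (boundaryEquation P).totalDegree = 0 := (isUnit_iff_totalDegree_of_isReduced.1 hP).2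
    rw [← hmul] at h1
    rw [← hPQ] at h2
    have h5 : P.totalDegree = 0 := by omega
    rw [totalDegree_eq_zero_iff_eq_C] at h5
    rw [h5] at hP0 ⊢
    exact (isUnit_iff_ne_zero.2 fun h0 => hP0 (by rw [h0, C_0])).map C
  refine ⟨fun hu => h.not_isUnit (hu.map _), fun P Q hPQ => ?_⟩
  have hmul : boundaryEquation F = boundaryEquation P * boundaryEquation Q := by
    rw [hPQ]; exact map_mul _ _ _
  rcases h.isUnit_or_isUnit hmul with hu | hu
  · exact Or.inl (key P Q hPQ hu)
  · exact Or.inr (key Q P (hPQ.trans (mul_comm _ _)) hu)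

/-! ### The dual complex of a nodal plane cubic -/

section Branches

variable {a b e : ℂ}

instance (G : MvPolynomial (Fin 3) ℂ) : DiscreteTopology (Component G) := ⟨rfl⟩

instance (G : MvPolynomial (Fin 3) ℂ) : DiscreteTopology (NodePoint G) := ⟨rfl⟩

instance (G : MvPolynomial (Fin 3) ℂ) : DiscreteTopology (Branch G) := ⟨rfl⟩

/-- The line in the plane where a coordinate vanishes. -/
def coordLine (i : Fin 3) : Submodule ℂ (Fin 3 → ℂ) :=
  LinearMap.ker (LinearMap.proj i : (Fin 3 → ℂ) →ₗ[ℂ] ℂ)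

theorem mem_coordLine {i : Fin 3} {w : Fin 3 → ℂ} : w ∈ coordLine i ↔ w i = 0 := Iff.rfl

theorem finrank_coordLine (i : Fin 3) : Module.finrank ℂ (coordLine i) = 2 := by
  have h := LinearMap.finrank_range_add_finrank_ker (LinearMap.proj i : (Fin 3 → ℂ) →ₗ[ℂ] ℂ)
  rw [LinearMap.range_eq_top.2 (LinearMap.proj_surjective i), finrank_top, Module.finrank_self,
    Module.finrank_fin_fun] at h
  have : Module.finrank ℂ (coordLine i) =
    Module.finrank ℂ (LinearMap.ker (LinearMap.proj i : (Fin 3 → ℂ) →ₗ[ℂ] ℂ)) := rfl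
  omega

theorem dotProduct_hessian_nodalCubic (c : ℂ) (w : Fin 3 → ℂ) :
    w ⬝ᵥ (hessian (nodalCubic a b e) ![0, 0, c] *ᵥ w) = 2 * (a * c) * (w 0 * w 1) := by
  rw [hessian_nodalCubic]
  simp [dotProduct, Matrix.mulVec, Fin.sum_univ_three]
  ring

theorem coordLine_zero_ne_one : coordLine 0 ≠ coordLine 1 := by
  intro h
  have : (![0, 1, 0] : Fin 3 → ℂ) ∈ coordLine 1 := by
    rw [← h, mem_coordLine]; rfl
  exact one_ne_zero (mem_coordLine.1 this)

/-- A subspace contained in a union of two subspaces lies in one of them. Thus the tangent cone xy =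
0 contains exactly two candidates for a branch. -/
theorem le_coordLine_of_mul_eq_zero {L : Submodule ℂ (Fin 3 → ℂ)}
    (h : ∀ w ∈ L, w 0 * w 1 = 0) : L ≤ coordLine 0 ∨ L ≤ coordLine 1 := by
  by_contra hc
  rw [not_or, SetLike.not_le_iff_exists, SetLike.not_le_iff_exists] at hc
  obtain ⟨⟨w, hw, hw0⟩, ⟨w', hw', hw1⟩⟩ := hc
  rw [mem_coordLine] at hw0 hw1
  have e1 := h w hw
  have e2 := h w' hw'
  have e3 := h _ (L.add_mem hw hw')
  have f1 : w 1 = 0 := (mul_eq_zero.1 e1).resolve_left hw0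
  have f2 : w' 0 = 0 := (mul_eq_zero.1 e2).resolve_right hw1
  simp [f1, f2, hw0, hw1] at e3

/-- The node, as a point of the dual complex. -/
def theNode (ha : a ≠ 0) (hb : b ≠ 0) (he : e ≠ 0) : NodePoint (nodalCubic a b e) :=
  ⟨nodePoint, by rw [singularLocus_nodalCubic ha hb he]; rfl⟩

theorem NodePoint.eq_theNode (ha : a ≠ 0) (hb : b ≠ 0) (he : e ≠ 0)
    (P : NodePoint (nodalCubic a b e)) : P = theNode ha hb he := by
  have hP : P.1 ∈ ({nodePoint} : Set _) := singularLocus_nodalCubic ha hb he ▸ P.2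
  exact Subtype.ext hP

/-- The branch at the node with a given tangent line. -/
def coordBranch (ha : a ≠ 0) (hb : b ≠ 0) (he : e ≠ 0) (i : Fin 3) (hi : i = 0 ∨ i = 1) :
    Branch (nodalCubic a b e) where
  node := theNode ha hb he
  line := coordLine i
  finrank_line := finrank_coordLine i
  mem_line := by
    obtain ⟨c, -, h⟩ := exists_rep_nodePoint
    rw [theNode, Projectivization.submodule_eq, h, Submodule.span_singleton_le_iff_mem,
      mem_coordLine]
    rcases hi with rfl | rfl <;> rfl
  tangent := by
    intro w hw
    obtain ⟨c, -, h⟩ := exists_rep_nodePoint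
    rw [theNode, h, dotProduct_hessian_nodalCubic]
    rw [mem_coordLine] at hw
    rcases hi with rfl | rfl <;> simp [hw]

theorem Branch.line_eq (ha : a ≠ 0) (hb : b ≠ 0) (he : e ≠ 0)
    (B : Branch (nodalCubic a b e)) : B.line = coordLine 0 ∨ B.line = coordLine 1 := by
  obtain ⟨c, hc, h⟩ := exists_rep_nodePoint
  have hrep : B.node.1.rep = ![0, 0, c] := by
    rw [B.node.eq_theNode ha hb he]
    exact h
  refine (le_coordLine_of_mul_eq_zero (L := B.line) fun w hw => ?_).imp ?_ ?_
  · have := B.tangent w hw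
    rw [hrep, dotProduct_hessian_nodalCubic] at this
    exact (mul_eq_zero.1 this).resolve_left (mul_ne_zero two_ne_zero (mul_ne_zero ha hc))
  all_goals
    intro hle
    exact Submodule.eq_of_le_of_finrank_eq hle (B.finrank_line.trans (finrank_coordLine _).symm)

theorem Branch.eq_of_line_eq (ha : a ≠ 0) (hb : b ≠ 0) (he : e ≠ 0)
    {B B' : Branch (nodalCubic a b e)} (h : B.line = B'.line) : B = B' := by
  have hn : B.node = B'.node := (B.node.eq_theNode ha hb he).trans (B'.node.eq_theNode ha hb he).symm
  cases B
  cases B'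
  simp only at h hn
  subst h hn
  rfl

/-- The unique component of an irreducible curve. -/
def theComponent {G : MvPolynomial (Fin 3) ℂ} (hG : Irreducible G) : Component G :=
  ⟨Ideal.span {G}, by
    have := (Ideal.span_singleton_prime hG.ne_zero).2 hG.prime
    rw [Ideal.minimalPrimes_eq_subsingleton_self]
    rfl⟩

theorem Component.eq_theComponent {G : MvPolynomial (Fin 3) ℂ} (hG : Irreducible G)
    (K : Component G) : K = theComponent hG := by
  have := (Ideal.span_singleton_prime hG.ne_zero).2 hG.prime
  have hK : K.1 ∈ ({Ideal.span {G}} : Set _) :=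
    (Ideal.minimalPrimes_eq_subsingleton_self (I := Ideal.span {G})) ▸ K.2
  exact Subtype.ext hK

/-- Every multiple of `G` vanishes to second order at a singular point. -/
theorem Branch.liesOn_of_irreducible {G : MvPolynomial (Fin 3) ℂ} (hG : Irreducible G)
    (B : Branch G) (K : Component G) : B.LiesOn K := by
  rw [K.eq_theComponent hG]
  intro H hH
  obtain ⟨q, rfl⟩ := Ideal.mem_span_singleton.1 hH
  obtain ⟨h0, h1⟩ := B.node.2
  simp [h0, h1]

end Branches

/-! ### One vertex with one loop: the body is a circle -/

section Circle

variable {G : MvPolynomial (Fin 3) ℂ}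

/-- The two half-edges are wrapped onto the two closed semicircles, the midpoint going to 1 and the
vertex to -1. -/
theorem nonempty_dualBody_homotopyEquiv_circle (K₀ : Component G) (hK : ∀ K, K = K₀)
    (N₀ : NodePoint G) (hN : ∀ N, N = N₀) (B₀ B₁ : Branch G) (hne : B₁ ≠ B₀)
    (hB : ∀ B, B = B₀ ∨ B = B₁) (hL : ∀ (B : Branch G) K, B.LiesOn K) :
    Nonempty (DualBody G ≃ₕ Circle) := by
  classical
  have : Subsingleton (Component G) := ⟨fun x y => (hK x).trans (hK y).symm⟩
  have : Subsingleton (NodePoint G) := ⟨fun x y => (hN x).trans (hN y).symm⟩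
  have : Finite (Branch G) := by
    refine Finite.of_surjective (fun i : Bool => if i then B₀ else B₁) fun B => ?_
    rcases hB B with rfl | rfl
    · exact ⟨true, rfl⟩
    · exact ⟨false, rfl⟩
  let sgn : Branch G → ℝ := fun B => if B = B₀ then 1 else -1
  have sgn0 : sgn B₀ = 1 := by simp [sgn]
  have sgn1 : sgn B₁ = -1 := by simp [sgn, hne]
  let g : DualCells G → Circle := Sum.elim (Sum.elim (fun _ => Circle.exp Real.pi) fun _ => 1)
    fun p => Circle.exp (sgn p.1 * (Real.pi * p.2))
  have hg : Continuous g := by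
    refine continuous_sumElim.2 ⟨continuous_sumElim.2 ⟨continuous_const, continuous_const⟩, ?_⟩
    have hs : Continuous sgn := continuous_of_discreteTopology
    fun_prop
  have hneg : Circle.exp (-Real.pi) = Circle.exp Real.pi :=
    Circle.exp_eq_exp.2 ⟨-1, by push_cast; ring⟩
  let f : DualBody G → Circle := Quot.lift g (by
    rintro _ _ (⟨B⟩ | ⟨B, K, h⟩)
    · simp [g]
    · rcases hB B with rfl | rfl
      · simp [g, sgn0]
      · simp [g, sgn1, hneg])
  have hf : Continuous f := continuous_quot_lift _ hg
  -- Vertex and midpoint are ends of half-edges, so injectivity concerns half-edges only.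
  have hrep : ∀ q : DualBody G, ∃ (B : Branch G) (x : unitInterval),
      q = Quot.mk _ (Sum.inr (B, x)) := by
    intro q
    induction q using Quot.ind with
    | mk c =>
    rcases c with (K | N) | ⟨B, x⟩
    · exact ⟨B₀, 1, (Quot.sound (DualGlue.vert B₀ K (hL _ _))).symm⟩
    · rw [(hN N).trans (hN B₀.node).symm]
      exact ⟨B₀, 0, (Quot.sound (DualGlue.mid B₀)).symm⟩
    · exact ⟨B, x, rfl⟩
  have hfr : ∀ (B : Branch G) (x : unitInterval), f (Quot.mk _ (Sum.inr (B, x))) =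
      Circle.exp (sgn B * (Real.pi * x)) := fun _ _ => rfl
  have hpi := Real.pi_pos
  have hsame : ∀ (r : ℝ) (x y : unitInterval), (r = 1 ∨ r = -1) →
      Circle.exp (r * (Real.pi * x)) = Circle.exp (r * (Real.pi * y)) → x = y := by
    intro r x y hr h
    obtain ⟨m, hm⟩ := Circle.exp_eq_exp.1 h
    have hm' : r * ((x : ℝ) - y) = 2 * m := by
      refine mul_left_cancel₀ hpi.ne' ?_
      linear_combination hm
    have hx := x.2
    have hy := y.2
    have hlt : -1 < (m : ℝ) ∧ (m : ℝ) < 1 := by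
      rcases hr with rfl | rfl <;> constructor <;> linarith [hx.1, hx.2, hy.1, hy.2]
    have hm0 : m = 0 := by
      have h1 : -1 < m := by exact_mod_cast hlt.1
      have h2 : m < 1 := by exact_mod_cast hlt.2
      omega
    rw [hm0, Int.cast_zero, mul_zero] at hm'
    have hr0 : r ≠ 0 := by rcases hr with rfl | rfl <;> norm_num
    exact Subtype.ext (sub_eq_zero.1 ((mul_eq_zero.1 hm').resolve_left hr0))
  have hdiff : ∀ x y : unitInterval, f (Quot.mk _ (Sum.inr (B₀, x))) =
      f (Quot.mk _ (Sum.inr (B₁, y))) →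
      (Quot.mk _ (Sum.inr (B₀, x)) : DualBody G) = Quot.mk _ (Sum.inr (B₁, y)) := by
    intro x y h
    rw [hfr, hfr, sgn0, sgn1] at h
    obtain ⟨m, hm⟩ := Circle.exp_eq_exp.1 h
    -- Hence both parameters are 0 or both are 1: the half-edges meet only at the midpoint and at
    -- the vertex.
    have hm' : (x : ℝ) + y = 2 * m := by
      refine mul_left_cancel₀ hpi.ne' ?_
      linear_combination hm
    have hx := x.2
    have hy := y.2
    have h1 : (-1 : ℝ) < m := by linarith [hx.1, hx.2, hy.1, hy.2]
    have h2 : (m : ℝ) < 2 := by linarith [hx.1, hx.2, hy.1, hy.2]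
    have h1' : -1 < m := by exact_mod_cast h1
    have h2' : m < 2 := by exact_mod_cast h2
    obtain rfl | rfl : m = 0 ∨ m = 1 := by omega
    · have hx0 : x = 0 := Subtype.ext (by
        push_cast at hm' ⊢
        linarith [hx.1, hy.1])
      have hy0 : y = 0 := Subtype.ext (by
        push_cast at hm' ⊢
        linarith [hx.1, hy.1])
      rw [hx0, hy0, Quot.sound (DualGlue.mid B₀), Quot.sound (DualGlue.mid B₁), hN B₀.node,
        hN B₁.node]
    · have hx0 : x = 1 := Subtype.ext (by
        push_cast at hm' ⊢
        linarith [hx.2, hy.2])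
      have hy0 : y = 1 := Subtype.ext (by
        push_cast at hm' ⊢
        linarith [hx.2, hy.2])
      rw [hx0, hy0, Quot.sound (DualGlue.vert B₀ K₀ (hL _ _)),
        Quot.sound (DualGlue.vert B₁ K₀ (hL _ _))]
  have hinj : Function.Injective f := by
    intro p q h
    obtain ⟨B, x, rfl⟩ := hrep p
    obtain ⟨B', y, rfl⟩ := hrep q
    rcases hB B with rfl | rfl <;> rcases hB B' with rfl | rfl
    · rw [hsame _ x y (Or.inl sgn0) h]
    · exact hdiff x y h
    · exact (hdiff y x h.symm).symm
    · rw [hsame _ x y (Or.inr sgn1) h]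
  have hsurj : Function.Surjective f := by
    intro z
    have h1 := Complex.neg_pi_lt_arg (z : ℂ)
    have h2 := Complex.arg_le_pi (z : ℂ)
    by_cases h : 0 ≤ Complex.arg (z : ℂ)
    · refine ⟨Quot.mk _ (Sum.inr (B₀, ⟨Complex.arg z / Real.pi, by positivity,
        (div_le_one hpi).2 h2⟩)), ?_⟩
      rw [hfr, sgn0, one_mul, mul_div_cancel₀ _ hpi.ne', Circle.exp_arg]
    · refine ⟨Quot.mk _ (Sum.inr (B₁, ⟨-Complex.arg z / Real.pi,
        div_nonneg (by linarith) hpi.le, (div_le_one hpi).2 (by linarith)⟩)), ?_⟩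
      rw [hfr, sgn1, mul_div_cancel₀ _ hpi.ne', neg_mul_neg, one_mul, Circle.exp_arg]
  -- A continuous bijection from a compact space to a Hausdorff one. Compactness comes from the
  -- finiteness of the cells.
  exact ⟨(Continuous.homeoOfEquivCompactToT2 (f := Equiv.ofBijective f ⟨hinj, hsurj⟩)
    hf).toHomotopyEquiv⟩

theorem nonempty_dualBody_nodalCubic {a b e : ℂ} (ha : a ≠ 0) (hb : b ≠ 0) (he : e ≠ 0) :
    Nonempty (DualBody (nodalCubic a b e) ≃ₕ Circle) := by
  have hG := irreducible_nodalCubic ha hb he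
  refine nonempty_dualBody_homotopyEquiv_circle (theComponent hG) (fun K => K.eq_theComponent hG)
    (theNode ha hb he) (fun N => N.eq_theNode ha hb he)
    (coordBranch ha hb he 0 (Or.inl rfl)) (coordBranch ha hb he 1 (Or.inr rfl)) ?_ ?_
    (fun B K => B.liesOn_of_irreducible hG K)
  · intro h
    exact coordLine_zero_ne_one (congrArg Branch.line h).symm
  · intro B
    exact (B.line_eq ha hb he).imp (fun h => Branch.eq_of_line_eq ha hb he h)
      (fun h => Branch.eq_of_line_eq ha hb he h)

end Circle

end CharVarCompactification

end

open CharVarCompactification in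
/-- Let `lam`, `mu`, `nu` be triples of distinct nonzero numbers, the eigenvalues at the three
punctures, with the necessary determinant relation. The character variety is the complement, in a
projective cubic surface with finitely many singular points, of these points and of a plane section
of type `I₁` along which the surface is smooth; for generic eigenvalues the surface is smooth. -/
theorem theorem1p2 (lam mu nu : Fin 3 → ℂ)
    (hlam : Function.Injective lam) (hmu : Function.Injective mu) (hnu : Function.Injective nu)
    (hlam0 : ∀ i, lam i ≠ 0) (hmu0 : ∀ i, mu i ≠ 0)
    (hdet : (∏ i, lam i) * ∏ i, mu i = ∏ i, nu i) :
    ∃ F : MvPolynomial (Fin 4) ℂ,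
      F.IsHomogeneous 3 ∧ Irreducible F ∧
      CharVarIso lam mu nu (hypersurface F \ (boundary F ∪ singularLocus F)) ∧
      (singularLocus F).Finite ∧
      Disjoint (singularLocus F) (boundary F) ∧
      ((∀ i j k, lam i * mu j ≠ nu k) →
        singularLocus F = ∅ ∧ CharVarIso lam mu nu (hypersurface F \ boundary F)) ∧
      IsTypeI1 (boundaryEquation F) ∧
      Nonempty (DualBody (boundaryEquation F) ≃ₕ Circle) := by
  obtain ⟨β, γ, ha⟩ := exists_adapted hlam hlam0 mu nu
  have hl : ∏ i, lam i ≠ 0 := Finset.prod_ne_zero_iff.2 fun i _ => hlam0 i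
  have hm : ∏ i, mu i ≠ 0 := Finset.prod_ne_zero_iff.2 fun i _ => hmu0 i
  have hg : ∏ i, gap lam i ≠ 0 := Finset.prod_ne_zero_iff.2 fun i _ => gap_ne_zero hlam i
  have hF := cubic_isHomogeneous lam β γ (∏ i, mu i)
  have hG := boundaryEquation_cubic lam β γ (∏ i, mu i)
  have hiso := charVarIso_smoothAffine hlam hmu hnu hlam0 hmu0 hdet ha
  refine ⟨cubic lam β γ (∏ i, mu i), hF, ?_, hiso,
    singularLocus_finite hlam hmu hnu hlam0 hmu0 hdet ha,
    disjoint_singularLocus_boundary hlam hlam0 hm, fun hgen => ?_, ?_, ?_⟩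
  · exact irreducible_of_boundaryEquation hF (hG ▸ irreducible_nodalCubic hg hm hl)
  · have hs := singularLocus_eq_empty hlam hmu hnu hlam0 hmu0 hdet ha hgen
    refine ⟨hs, ?_⟩
    rwa [smoothAffine, hs, Set.union_empty] at hiso
  · rw [hG]
    exact isTypeI1_nodalCubic hg hm hl
  · rw [hG]
    exact nonempty_dualBody_nodalCubic hg hm hl
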